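/- There is a function $\epsilon:\mathbb N\to\mathbb R$ with $\epsilon(n)=o(n)$ as $n\to\infty$ such that the following holds. Let $n\ge 1$, and let $C\subseteq\mathbb F_2^n$ be a binary linear code that is doubly transitive, i.e. the group of coordinate permutations preserving $C$ acts doubly transitively on the $n$ coordinates. Let $R=\dim(C)/n$ be the rate of $C$, let $a_i$ be the number of codewords of $C$ of Hamming weight $i$, and write $i^*=\min\{i,n-i\}$. Then for every $0\le i\le n$: 1. if $R<1$, then $$a_i\;\le\;2^{\epsilon(n)}\cdot\left(\frac{1}{2^{1-R}-1}\right)^{i^*};$$ 2. $$a_i\;\le\;2^{\epsilon(n)}\cdot\begin{cases}\dfrac{|C|}{(2-2^R)^{i^*}\,(2^R)^{n-i^*}} & \text{if } i^*\le(1-2^{R-1})\,n,\\[2ex] \dfrac{\binom{n}{i^*}\,|C|}{2^n} & \text{otherwise,}\end{cases}$$ where $0^0=1$ (this matters only for $R=1$, $i^*=0$). -/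

import Mathlib

open Asymptotics Filter

/-- A binary linear code of length `n`: a linear subspace of `𝔽₂ⁿ`. -/
abbrev BinaryLinearCode (n : ℕ) : Type := Submodule (ZMod 2) (Fin n → ZMod 2)

namespace BinaryLinearCode

/-- The (permutation) automorphism group of a code: all permutations of the
coordinates that map the code onto itself. -/
def autGroup {n : ℕ} (C : BinaryLinearCode n) : Subgroup (Equiv.Perm (Fin n)) where
  carrier := {π | ∀ x : Fin n → ZMod 2, (fun j => x (π j)) ∈ C ↔ x ∈ C}
  one_mem' := fun _ => Iff.rfl
  mul_mem' := fun {π σ} hπ hσ x => (hσ fun j => x (π j)).trans (hπ x)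
  inv_mem' := fun {π} hπ x => by
    have h := hπ fun j => x (π⁻¹ j)
    simp only [← Equiv.Perm.mul_apply, inv_mul_cancel, Equiv.Perm.one_apply] at h
    exact h.symm

/-- A code is doubly transitive if its automorphism group acts doubly transitively on the
coordinates: every ordered pair of distinct coordinates can be mapped to every other one. -/
def IsDoublyTransitive {n : ℕ} (C : BinaryLinearCode n) : Prop :=
  MulAction.IsMultiplyPretransitive C.autGroup (Fin n) 2

/-- The rate `dim C / n` of a code of length `n`. -/
noncomputable def rate {n : ℕ} (C : BinaryLinearCode n) : ℝ :=
  (Module.finrank (ZMod 2) C : ℝ) / n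

/-- The weight distribution: the number `a_i` of codewords of Hamming weight `i`. -/
noncomputable def weightDistribution {n : ℕ} (C : BinaryLinearCode n) (i : ℕ) : ℕ :=
  Set.ncard {x : Fin n → ZMod 2 | x ∈ C ∧ hammingNorm x = i}

end BinaryLinearCode

/-! Choose a random set of coordinates containing each one independently with probability t, and let
D(t) be the mean dimension of the subcode supported in it (`meanDim`). Everything follows from D(1 -
R) = o(n), uniformly over doubly transitive codes.

From D to weights: α^|z| is the probability that a random set of density α contains the support of
z, so the weight enumerator of any coset of C at α is at most E 2^dim. Adding a coordinate raises
dim by 0 or 1, and for such functions `logb_ex_le` gives log₂ E_θ 2^dim ≤ D(log₂(1 + θ)). Taking θ =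
2^(1-R) - 1 lands at 1 - R and proves the first bound. For the second, the same inequality is
applied to the dual code through MacWilliams duality (`ex_suppDim_eq_ex_dualSupp`); it again meets
D(1 - R), and α is optimised over the range this allows. The coset of the all-ones vector exchanges
i and n - i.

Sublinearity of D(1 - R) is a sharp threshold phenomenon. By Russo's formula and transitivity D' = n
p, where p(t) is the probability that a fixed coordinate is free (`IsFree`); p is increasing with
integral R. If p jumped from 0 to 1, the jump would sit at 1 - R, and D(1 - R) would be the
negligible area before it. Quantitatively, D(1 - R) > δn forces δ/2 ≤ p ≤ 1 - δ on an interval of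
length δ/2, so p' ≤ 2/δ somewhere. There p' is a sum of influences, equal by double transitivity,
hence each O(1/n), and `falik_samorodnitsky` makes p' at least of order log n: a contradiction for
large n. -/

namespace BiasedCube

/-! ### Product measures on the cube: coordinate averages, expectations, Russo's formula. -/

section Averages

variable {ι : Type*} [DecidableEq ι]

/-- The average over one coordinate. -/
def avg (w : ι → ℝ) (i : ι) (f : (ι → Bool) → ℝ) : (ι → Bool) → ℝ := fun x =>
  w i * f (Function.update x i true) + (1 - w i) * f (Function.update x i false)

lemma avg_comm (w : ι → ℝ) (i k : ι) (f : (ι → Bool) → ℝ) :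
    avg w i (avg w k f) = avg w k (avg w i f) := by
  funext x
  by_cases h : i = k
  · rw [h]
  · simp only [avg]
    simp only [Function.update_comm h]
    ring

lemma avg_sub (w : ι → ℝ) (i : ι) (f g : (ι → Bool) → ℝ) :
    avg w i (f - g) = avg w i f - avg w i g := by
  funext x
  simp only [avg, Pi.sub_apply]
  ring

end Averages

section Expectation

variable {ι : Type*} [Fintype ι]

/-- The weight of a point of the cube under the product measure with marginals `w`. -/
def wt (w : ι → ℝ) (x : ι → Bool) : ℝ := ∏ i, if x i then w i else 1 - w i

/-- The expectation under the product measure with marginals `w`. -/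
def ex [DecidableEq ι] (w : ι → ℝ) (f : (ι → Bool) → ℝ) : ℝ := ∑ x, wt w x * f x

lemma wt_nonneg {w : ι → ℝ} (h0 : ∀ i, 0 ≤ w i) (h1 : ∀ i, w i ≤ 1) (x : ι → Bool) :
    0 ≤ wt w x :=
  Finset.prod_nonneg fun i _ => by
    split_ifs
    · exact h0 i
    · linarith [h1 i]

lemma wt_not (w : ι → ℝ) (x : ι → Bool) :
    wt w (fun i => !x i) = wt (fun i => 1 - w i) x := by
  unfold wt
  refine Finset.prod_congr rfl fun i _ => ?_
  cases h : x i <;> simp [h]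

variable [DecidableEq ι]

lemma ex_prod (w : ι → ℝ) (g : ι → Bool → ℝ) :
    ex w (fun x => ∏ i, g i (x i)) = ∏ i, (w i * g i true + (1 - w i) * g i false) := by
  have h := Finset.prod_univ_sum (fun _ : ι => (Finset.univ : Finset Bool))
    (fun i b => (if b then w i else 1 - w i) * g i b)
  simp only [Fintype.sum_bool, Fintype.piFinset_univ] at h
  simp only [ex, wt, ← Finset.prod_mul_distrib]
  simpa using h.symm

lemma ex_const (w : ι → ℝ) (c : ℝ) : ex w (fun _ => c) = c := by
  have h := ex_prod w (fun _ _ => 1)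
  simp only [ex, Finset.prod_const_one, mul_one, add_sub_cancel, ← Finset.sum_mul] at h ⊢
  rw [h, one_mul]

lemma ex_add (w : ι → ℝ) (f g : (ι → Bool) → ℝ) :
    ex w (fun x => f x + g x) = ex w f + ex w g := by
  simp [ex, mul_add, Finset.sum_add_distrib]

lemma ex_sub (w : ι → ℝ) (f g : (ι → Bool) → ℝ) :
    ex w (fun x => f x - g x) = ex w f - ex w g := by
  simp [ex, mul_sub, Finset.sum_sub_distrib]

lemma ex_const_mul (w : ι → ℝ) (c : ℝ) (f : (ι → Bool) → ℝ) :
    ex w (fun x => c * f x) = c * ex w f := by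
  simp only [ex, Finset.mul_sum]
  exact Finset.sum_congr rfl fun x _ => by ring

lemma ex_sum {κ : Type*} (s : Finset κ) (w : ι → ℝ) (f : κ → (ι → Bool) → ℝ) :
    ex w (fun x => ∑ k ∈ s, f k x) = ∑ k ∈ s, ex w (f k) := by
  simp only [ex, Finset.mul_sum]
  exact Finset.sum_comm

lemma ex_mono {w : ι → ℝ} (h0 : ∀ i, 0 ≤ w i) (h1 : ∀ i, w i ≤ 1) {f g : (ι → Bool) → ℝ}
    (h : ∀ x, f x ≤ g x) : ex w f ≤ ex w g :=
  Finset.sum_le_sum fun x _ => mul_le_mul_of_nonneg_left (h x) (wt_nonneg h0 h1 x)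

lemma ex_nonneg {w : ι → ℝ} (h0 : ∀ i, 0 ≤ w i) (h1 : ∀ i, w i ≤ 1) {f : (ι → Bool) → ℝ}
    (h : ∀ x, 0 ≤ f x) : 0 ≤ ex w f :=
  Finset.sum_nonneg fun x _ => mul_nonneg (wt_nonneg h0 h1 x) (h x)

lemma ex_pos {w : ι → ℝ} (h0 : ∀ i, 0 ≤ w i) (h1 : ∀ i, w i ≤ 1) {f : (ι → Bool) → ℝ}
    (h : ∀ x, 0 < f x) : 0 < ex w f := by
  obtain ⟨x₀, -, hx₀⟩ := Finset.exists_min_image Finset.univ f Finset.univ_nonempty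
  have h2 : ex w (fun _ => f x₀) ≤ ex w f := ex_mono h0 h1 fun x => hx₀ x (Finset.mem_univ x)
  rw [ex_const] at h2
  linarith [h x₀]

lemma wt_update (w : ι → ℝ) (i : ι) (c : ℝ) (x : ι → Bool) :
    wt (Function.update w i c) x =
      (∏ j ∈ Finset.univ.erase i, if x j then w j else 1 - w j) * (if x i then c else 1 - c) := by
  rw [wt, ← Finset.prod_erase_mul _ _ (Finset.mem_univ i)]
  congr 1
  · refine Finset.prod_congr rfl fun j hj => ?_
    rw [Function.update_of_ne (Finset.ne_of_mem_erase hj)]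
  · simp

lemma sum_update_flip (i : ι) (F : (ι → Bool) → ℝ) :
    ∑ x, F (Function.update x i (!x i)) = ∑ x, F x := by
  refine Fintype.sum_bijective (fun x : ι → Bool => Function.update x i (!x i)) ?_ _ _ fun _ => rfl
  refine Function.Involutive.bijective fun x => ?_
  simp

lemma ex_avg (w : ι → ℝ) (i : ι) (f : (ι → Bool) → ℝ) : ex w (avg w i f) = ex w f := by
  have key : ∀ x : ι → Bool, ∀ F : (ι → Bool) → ℝ,
      F x + F (Function.update x i (!x i)) =
        F (Function.update x i true) + F (Function.update x i false) := by
    intro x F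
    cases h : x i
    · have : Function.update x i false = x := by rw [← h]; simp
      simp [this, add_comm]
    · have : Function.update x i true = x := by rw [← h]; simp
      simp [this]
  have hw : ∀ x : ι → Bool, ∀ b : Bool, wt w (Function.update x i b) =
      (∏ j ∈ Finset.univ.erase i, if x j then w j else 1 - w j) *
        (if b then w i else 1 - w i) := by
    intro x b
    have := wt_update w i (w i) (Function.update x i b)
    rw [Function.update_eq_self] at this
    rw [this]
    simp only [Function.update_self]
    congr 1
    refine Finset.prod_congr rfl fun j hj => ?_
    rw [Function.update_of_ne (Finset.ne_of_mem_erase hj)]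
  have h2 : ∀ F : (ι → Bool) → ℝ, 2 * ∑ x, F x =
      ∑ x, (F (Function.update x i true) + F (Function.update x i false)) := by
    intro F
    rw [two_mul]
    nth_rewrite 2 [← sum_update_flip i F]
    rw [← Finset.sum_add_distrib]
    exact Finset.sum_congr rfl fun x _ => key x F
  have : 2 * ex w (avg w i f) = 2 * ex w f := by
    unfold ex
    rw [h2, h2]
    refine Finset.sum_congr rfl fun x _ => ?_
    simp only [hw, avg, Function.update_idem]
    simp
    ring
  linarith

/-- The expectation is affine in the marginal of `i`, and flipping that coordinate shows that its
values at the marginals 0 and 1 agree. -/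
lemma ex_update_of_indep (w : ι → ℝ) (i : ι) (c : ℝ) (f : (ι → Bool) → ℝ)
    (hf : ∀ x b, f (Function.update x i b) = f x) : ex (Function.update w i c) f = ex w f := by
  have h1 : ∀ c, ex (Function.update w i c) f =
      c * ex (Function.update w i 1) f + (1 - c) * ex (Function.update w i 0) f := by
    intro c
    simp only [ex, wt_update, Finset.mul_sum, ← Finset.sum_add_distrib]
    refine Finset.sum_congr rfl fun x _ => ?_
    split_ifs <;> ring
  have h2 : ex (Function.update w i 1) f = ex (Function.update w i 0) f := by
    rw [ex, ex, ← sum_update_flip i]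
    refine Finset.sum_congr rfl fun x _ => ?_
    rw [hf, wt_update, wt_update]
    congr 2
    · refine Finset.prod_congr rfl fun j hj => ?_
      rw [Function.update_of_ne (Finset.ne_of_mem_erase hj)]
    · cases x i <;> simp
  have h3 : ∀ c, ex (Function.update w i c) f = ex (Function.update w i 0) f := by
    intro c; rw [h1, h2]; ring
  rw [h3 c, ← h3 (w i), Function.update_eq_self]

lemma ex_update_one (w : ι → ℝ) (i : ι) (f : (ι → Bool) → ℝ) :
    ex (Function.update w i 1) f = ex w (fun x => f (Function.update x i true)) := by
  rw [← ex_avg (Function.update w i 1) i f,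
    ← ex_update_of_indep w i 1 (fun x => f (Function.update x i true)) (by simp)]
  congr 1; funext x; simp [avg]

lemma ex_update_zero (w : ι → ℝ) (i : ι) (f : (ι → Bool) → ℝ) :
    ex (Function.update w i 0) f = ex w (fun x => f (Function.update x i false)) := by
  rw [← ex_avg (Function.update w i 0) i f,
    ← ex_update_of_indep w i 0 (fun x => f (Function.update x i false)) (by simp)]
  congr 1; funext x; simp [avg]

lemma ex_eq_update (w : ι → ℝ) (i : ι) (f : (ι → Bool) → ℝ) :
    ex w f = w i * ex (Function.update w i 1) f + (1 - w i) * ex (Function.update w i 0) f := by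
  rw [← ex_avg w i f, ex_update_one, ex_update_zero]
  unfold avg
  rw [ex_add, ex_const_mul, ex_const_mul]

/-- Russo's formula. -/
lemma hasDerivAt_ex (f : (ι → Bool) → ℝ) (t : ℝ) :
    HasDerivAt (fun t => ex (fun _ => t) f)
      (∑ i, ex (fun _ => t) (fun x =>
        f (Function.update x i true) - f (Function.update x i false))) t := by
  have h1 : ∀ x : ι → Bool, HasDerivAt (fun t => wt (fun _ => t) x)
      (∑ i, (wt (Function.update (fun _ => t) i 1) x -
        wt (Function.update (fun _ => t) i 0) x)) t := by
    intro x
    have := HasDerivAt.fun_finsetProd (u := Finset.univ)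
      (f := fun i (t : ℝ) => if x i then t else 1 - t)
      (f' := fun i => if x i then 1 else -1) (x := t) (fun i _ => by
        cases x i
        · simpa using (hasDerivAt_id' t).const_sub 1
        · simpa using hasDerivAt_id' t)
    unfold wt at *
    refine this.congr_deriv (Finset.sum_congr rfl fun i _ => ?_)
    have e := fun c => wt_update (fun _ : ι => t) i c x
    unfold wt at e
    rw [e, e, ← mul_sub, smul_eq_mul]
    cases x i <;> simp
  have h2 := HasDerivAt.fun_sum (u := Finset.univ)
    (A := fun (x : ι → Bool) (t : ℝ) => wt (fun _ => t) x * f x)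
    (fun x _ => (h1 x).mul_const (f x))
  refine h2.congr_deriv ?_
  simp only [ex_sub, ← ex_update_one, ← ex_update_zero]
  simp only [ex, Finset.sum_mul, sub_mul]
  rw [Finset.sum_comm]
  simp [Finset.sum_sub_distrib]

lemma ex_comp_perm (t : ℝ) (π : Equiv.Perm ι) (f : (ι → Bool) → ℝ) :
    ex (fun _ => t) (fun x => f (x ∘ π)) = ex (fun _ => t) f := by
  unfold ex
  refine Fintype.sum_equiv (Equiv.arrowCongr π.symm (Equiv.refl Bool)) _ _ fun x => ?_
  have : (Equiv.arrowCongr π.symm (Equiv.refl Bool)) x = x ∘ π := by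
    ext; simp
  rw [this]
  congr 1
  unfold wt
  exact (Equiv.prod_comp π (fun i => if x i then t else 1 - t)).symm

/-- Pythagoras for the average over one coordinate. -/
lemma ex_sq_eq_avg (w : ι → ℝ) (i : ι) (f : (ι → Bool) → ℝ) :
    ex w (fun x => f x ^ 2) =
      ex w (fun x => avg w i f x ^ 2) + ex w (fun x => (f x - avg w i f x) ^ 2) := by
  rw [← ex_add, ← ex_avg w i, ← ex_avg w i (fun x => avg w i f x ^ 2 + _)]
  congr 1
  funext x
  simp only [avg, Function.update_idem]
  ring

end Expectation

/-! ### Comparing the logarithm of a mean with the mean of a logarithm. -/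

section LogInequality

variable {ι : Type*} [Fintype ι] [DecidableEq ι]

/-- Put u = c / a in [1, 2] and l = log₂(1 + θ). By concavity u^l lies above its chord 1 + θ(u - 1)
on [1, 2]; both ends are exact because 2^l = 1 + θ. -/
lemma logb_affine_le {a c θ : ℝ} (ha : 0 < a) (hac : a ≤ c) (hca : c ≤ 2 * a) (h0 : 0 ≤ θ)
    (h1 : θ ≤ 1) :
    Real.logb 2 (θ * c + (1 - θ) * a) ≤
      Real.logb 2 (1 + θ) * Real.logb 2 c + (1 - Real.logb 2 (1 + θ)) * Real.logb 2 a := by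
  set l := Real.logb 2 (1 + θ) with hl
  have hl0 : 0 ≤ l := Real.logb_nonneg (by norm_num) (by linarith)
  have hl1 : l ≤ 1 := by
    rw [hl, Real.logb_le_iff_le_rpow (by norm_num) (by linarith)]
    norm_num; linarith
  have hc : 0 < c := by linarith
  have h2l : (2 : ℝ) ^ l = 1 + θ := Real.rpow_logb (by norm_num) (by norm_num) (by linarith)
  have hu1 : 0 ≤ c / a - 1 := by rw [sub_nonneg, le_div_iff₀ ha]; linarith
  have hu2 : 0 ≤ 1 - (c / a - 1) := by
    have : c / a ≤ 2 := by rw [div_le_iff₀ ha]; linarith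
    linarith
  have key := (Real.concaveOn_rpow hl0 hl1).2 (x := 1) (y := 2) (by simp) (by simp) hu2 hu1
    (by ring)
  simp only [smul_eq_mul, Real.one_rpow, h2l] at key
  have e1 : (1 - (c / a - 1)) * 1 + (c / a - 1) * 2 = c / a := by ring
  rw [e1] at key
  have hpos : 0 < θ * c + (1 - θ) * a := by nlinarith [mul_nonneg h0 (sub_nonneg.2 hac)]
  have e2 : θ * c + (1 - θ) * a = a * ((1 - (c / a - 1)) * 1 + (c / a - 1) * (1 + θ)) := by
    field_simp; ring
  have h3 : θ * c + (1 - θ) * a ≤ a * (c / a) ^ l := by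
    rw [e2]; exact mul_le_mul_of_nonneg_left key ha.le
  have h4 := Real.logb_le_logb_of_le (b := 2) (by norm_num) hpos h3
  rw [Real.logb_mul ha.ne' (Real.rpow_pos_of_pos (by positivity) _).ne',
    Real.logb_rpow_eq_mul_logb_of_pos (by positivity), Real.logb_div hc.ne' ha.ne'] at h4
  linarith

lemma ex_vertex (x₀ : ι → Bool) (f : (ι → Bool) → ℝ) :
    ex (fun i => if x₀ i then 1 else 0) f = f x₀ := by
  unfold ex
  rw [Finset.sum_eq_single x₀]
  · have : wt (fun i => if x₀ i then (1 : ℝ) else 0) x₀ = 1 := by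
      unfold wt
      refine Finset.prod_eq_one fun i _ => ?_
      cases h : x₀ i <;> simp [h]
    rw [this, one_mul]
  · intro x _ hx
    obtain ⟨i, hi⟩ := Function.ne_iff.1 hx
    have : wt (fun i => if x₀ i then (1 : ℝ) else 0) x = 0 := by
      refine Finset.prod_eq_zero (Finset.mem_univ i) ?_
      revert hi
      cases h : x₀ i <;> cases x i <;> simp [h]
    rw [this, zero_mul]
  · simp

/-- The logarithm of the expectation of a monotone function that at most doubles along each
edge is at most the expectation of its logarithm under a larger bias. -/
lemma logb_ex_le {F : (ι → Bool) → ℝ} (hF : ∀ x, 0 < F x)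
    (hmono : ∀ x i, F (Function.update x i false) ≤ F (Function.update x i true))
    (hdouble : ∀ x i, F (Function.update x i true) ≤ 2 * F (Function.update x i false))
    {θ : ι → ℝ} (h0 : ∀ i, 0 ≤ θ i) (h1 : ∀ i, θ i ≤ 1) :
    Real.logb 2 (ex θ F) ≤ ex (fun i => Real.logb 2 (1 + θ i)) (fun x => Real.logb 2 (F x)) := by
  -- Outside `s` the marginals are already 0 or 1. These are the fixed points of θ ↦ log₂(1 + θ), so
  -- with `s` empty both sides are the value at one vertex.
  suffices H : ∀ s : Finset ι, ∀ θ : ι → ℝ, (∀ i, 0 ≤ θ i) → (∀ i, θ i ≤ 1) →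
      (∀ i ∉ s, θ i = 0 ∨ θ i = 1) → Real.logb 2 (ex θ F) ≤
        ex (fun i => Real.logb 2 (1 + θ i)) (fun x => Real.logb 2 (F x)) from
    H Finset.univ θ h0 h1 (by simp)
  intro s
  induction s using Finset.induction_on with
  | empty =>
    intro θ h0 h1 hv
    have e1 : θ = fun i => if (decide (θ i = 1)) then (1 : ℝ) else 0 := by
      funext i
      rcases hv i (by simp) with h | h <;> simp [h]
    have e2 : (fun i => Real.logb 2 (1 + θ i)) = θ := by
      funext i
      rcases hv i (by simp) with h | h <;> simp [h]
      norm_num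
    rw [e2, e1, ex_vertex (fun i => decide (θ i = 1)), ex_vertex (fun i => decide (θ i = 1))]
  | insert i s hi ih =>
    intro θ h0 h1 hv
    have step : ∀ c : ℝ, c = 0 ∨ c = 1 → Real.logb 2 (ex (Function.update θ i c) F) ≤
        ex (Function.update (fun i => Real.logb 2 (1 + θ i)) i c)
          (fun x => Real.logb 2 (F x)) := by
      intro c hc
      have hc' : 0 ≤ c ∧ c ≤ 1 ∧ Real.logb 2 (1 + c) = c := by
        rcases hc with rfl | rfl <;> norm_num
      have := ih (Function.update θ i c)
        (fun j => by by_cases h : j = i <;> simp [h, hc', h0])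
        (fun j => by by_cases h : j = i <;> simp [h, hc', h1])
        (fun j hj => by
          by_cases h : j = i
          · simpa [h] using hc
          · simpa [Function.update_apply, h] using hv j (by simp [h, hj]))
      refine this.trans_eq ?_
      congr 1
      funext j
      by_cases h : j = i
      · subst h; simp [hc']
      · simp [h]
    have a0 := step 0 (Or.inl rfl)
    have a1 := step 1 (Or.inr rfl)
    rw [ex_eq_update (fun i => Real.logb 2 (1 + θ i)) i]
    rw [ex_eq_update θ i]
    have hl0 : 0 ≤ Real.logb 2 (1 + θ i) :=
      Real.logb_nonneg (by norm_num) (by linarith [h0 i])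
    have hl1 : Real.logb 2 (1 + θ i) ≤ 1 := by
      rw [Real.logb_le_iff_le_rpow (by norm_num) (by linarith [h0 i])]
      norm_num; linarith [h1 i]
    refine (logb_affine_le (a := ex (Function.update θ i 0) F) ?_ ?_ ?_ (h0 i) (h1 i)).trans ?_
    · rw [ex_update_zero]; exact ex_pos h0 h1 fun x => hF _
    · rw [ex_update_zero, ex_update_one]; exact ex_mono h0 h1 fun x => hmono x i
    · rw [ex_update_zero, ex_update_one, ← ex_const_mul]
      exact ex_mono h0 h1 fun x => hdouble x i
    · exact add_le_add (mul_le_mul_of_nonneg_left a1 hl0)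
        (mul_le_mul_of_nonneg_left a0 (by linarith))

end LogInequality

/-! ### Logarithmic Sobolev and Falik–Samorodnitsky inequalities. -/

/-- The two-point case, with a crude constant: log x ≤ x - 1 bounds the entropy by p(1 - p)(A - B)²
/ M with M the mean, and (√A + √B)² ≤ 2(A + B) ≤ 2M / m. -/
lemma mul_log_two_point_le {p A B m : ℝ} (hm : 0 < m) (hp : m ≤ p) (hq : m ≤ 1 - p)
    (hA : 0 ≤ A) (hB : 0 ≤ B) :
    p * (A * Real.log A) + (1 - p) * (B * Real.log B) -
      (p * A + (1 - p) * B) * Real.log (p * A + (1 - p) * B) ≤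
      2 / m * (p * (1 - p) * (√A - √B) ^ 2) := by
  have hp0 : 0 < p := by linarith
  have hq0 : 0 < 1 - p := by linarith
  set M := p * A + (1 - p) * B with hM
  have hM0 : 0 ≤ M := by positivity
  rcases hM0.eq_or_lt with h | hMpos
  · have hA0 : A = 0 := by nlinarith [mul_nonneg hp0.le hA, mul_nonneg hq0.le hB]
    have hB0 : B = 0 := by nlinarith [mul_nonneg hp0.le hA, mul_nonneg hq0.le hB]
    simp [hA0, hB0, hM]
  have hlog : ∀ x : ℝ, 0 ≤ x → x * Real.log x ≤ x * Real.log M + x * (x / M - 1) := by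
    intro x hx
    rcases hx.eq_or_lt with rfl | hx
    · simp
    · rw [← mul_add]
      refine mul_le_mul_of_nonneg_left ?_ hx.le
      have := Real.log_le_sub_one_of_pos (div_pos hx hMpos)
      rw [Real.log_div hx.ne' hMpos.ne'] at this
      linarith
  have h1 : p * (A * Real.log A) + (1 - p) * (B * Real.log B) - M * Real.log M ≤
      p * (1 - p) * (A - B) ^ 2 / M := by
    have e : p * (1 - p) * (A - B) ^ 2 / M =
        p * (A * (A / M - 1)) + (1 - p) * (B * (B / M - 1)) := by
      field_simp
      rw [hM]; ring
    rw [e]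
    have := mul_le_mul_of_nonneg_left (hlog A hA) hp0.le
    have := mul_le_mul_of_nonneg_left (hlog B hB) hq0.le
    have : M * Real.log M = p * (A * Real.log M) + (1 - p) * (B * Real.log M) := by
      rw [hM]; ring
    linarith
  refine h1.trans ?_
  rw [div_le_iff₀ hMpos]
  have hsA := Real.sq_sqrt hA
  have hsB := Real.sq_sqrt hB
  have e1 : (A - B) ^ 2 = (√A - √B) ^ 2 * (√A + √B) ^ 2 := by
    rw [← mul_pow, ← hsA, ← hsB]; simp only [Real.sqrt_sq (Real.sqrt_nonneg _)]; ring
  have e2 : (√A + √B) ^ 2 ≤ 2 / m * M := by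
    have : m * (A + B) ≤ M := by rw [hM]; nlinarith
    have h3 : (√A + √B) ^ 2 ≤ 2 * (A + B) := by nlinarith [sq_nonneg (√A - √B)]
    refine h3.trans ?_
    rw [div_mul_eq_mul_div, le_div_iff₀ hm]
    linarith
  rw [e1]
  calc p * (1 - p) * ((√A - √B) ^ 2 * (√A + √B) ^ 2)
      = p * (1 - p) * (√A - √B) ^ 2 * (√A + √B) ^ 2 := by ring
    _ ≤ p * (1 - p) * (√A - √B) ^ 2 * (2 / m * M) :=
        mul_le_mul_of_nonneg_left e2 (by positivity)
    _ = _ := by ring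

/-- Joint convexity of (a, c) ↦ (√a - √c)²; after expansion it is Cauchy–Schwarz for the cross
terms. -/
lemma sq_sqrt_sub_sqrt_le {p a b c d : ℝ} (hp : 0 ≤ p) (hq : 0 ≤ 1 - p) (ha : 0 ≤ a)
    (hb : 0 ≤ b) (hc : 0 ≤ c) (hd : 0 ≤ d) :
    (√(p * a + (1 - p) * b) - √(p * c + (1 - p) * d)) ^ 2 ≤
      p * (√a - √c) ^ 2 + (1 - p) * (√b - √d) ^ 2 := by
  have h1 : 0 ≤ p * a + (1 - p) * b := by positivity
  have h2 : 0 ≤ p * c + (1 - p) * d := by positivity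
  have key : p * (√a * √c) + (1 - p) * (√b * √d) ≤
      √(p * a + (1 - p) * b) * √(p * c + (1 - p) * d) := by
    rw [← Real.sqrt_mul h1]
    apply Real.le_sqrt_of_sq_le
    have := mul_nonneg (mul_nonneg hp hq) (sq_nonneg (√a * √d - √b * √c))
    have e : (p * a + (1 - p) * b) * (p * c + (1 - p) * d) =
      (p * √a ^ 2 + (1 - p) * √b ^ 2) * (p * √c ^ 2 + (1 - p) * √d ^ 2) := by
      rw [Real.sq_sqrt ha, Real.sq_sqrt hb, Real.sq_sqrt hc, Real.sq_sqrt hd]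
    rw [e]
    nlinarith
  have := Real.sq_sqrt h1
  have := Real.sq_sqrt h2
  have := Real.sq_sqrt ha
  have := Real.sq_sqrt hb
  have := Real.sq_sqrt hc
  have := Real.sq_sqrt hd
  nlinarith

section Averages

variable {ι : Type*} [DecidableEq ι]

/-- The average over the coordinates in a list. -/
def avgList (w : ι → ℝ) (l : List ι) (f : (ι → Bool) → ℝ) : (ι → Bool) → ℝ :=
  l.foldr (avg w) f

lemma avg_mem_Icc {w : ι → ℝ} (h0 : ∀ i, 0 ≤ w i) (h1 : ∀ i, w i ≤ 1) (i : ι)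
    {f : (ι → Bool) → ℝ} {a b : ℝ} (hf : ∀ x, f x ∈ Set.Icc a b) (x : ι → Bool) :
    avg w i f x ∈ Set.Icc a b :=
  (convex_Icc a b) (hf _) (hf _) (h0 i) (by linarith [h1 i]) (by ring)

lemma avgList_mem_Icc {w : ι → ℝ} (h0 : ∀ i, 0 ≤ w i) (h1 : ∀ i, w i ≤ 1) (l : List ι)
    {f : (ι → Bool) → ℝ} {a b : ℝ} (hf : ∀ x, f x ∈ Set.Icc a b) (x : ι → Bool) :
    avgList w l f x ∈ Set.Icc a b := by
  induction l generalizing x with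
  | nil => exact hf x
  | cons i l ih => exact avg_mem_Icc h0 h1 i ih x

lemma avg_nonneg {w : ι → ℝ} (h0 : ∀ i, 0 ≤ w i) (h1 : ∀ i, w i ≤ 1) (i : ι)
    {f : (ι → Bool) → ℝ} (hf : ∀ x, 0 ≤ f x) (x : ι → Bool) : 0 ≤ avg w i f x :=
  add_nonneg (mul_nonneg (h0 i) (hf _)) (mul_nonneg (by linarith [h1 i]) (hf _))

lemma avgList_nonneg {w : ι → ℝ} (h0 : ∀ i, 0 ≤ w i) (h1 : ∀ i, w i ≤ 1) (l : List ι)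
    {f : (ι → Bool) → ℝ} (hf : ∀ x, 0 ≤ f x) (x : ι → Bool) : 0 ≤ avgList w l f x := by
  induction l generalizing x with
  | nil => exact hf x
  | cons i l ih => exact avg_nonneg h0 h1 i ih x

lemma abs_avg_le {w : ι → ℝ} (h0 : ∀ i, 0 ≤ w i) (h1 : ∀ i, w i ≤ 1) (i : ι)
    (f : (ι → Bool) → ℝ) (x : ι → Bool) : |avg w i f x| ≤ avg w i (fun x => |f x|) x := by
  have h1' := h1 i
  unfold avg
  refine (abs_add_le _ _).trans_eq ?_
  rw [abs_mul, abs_mul, abs_of_nonneg (h0 i), abs_of_nonneg (by linarith : 0 ≤ 1 - w i)]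

lemma avg_avgList (w : ι → ℝ) (i : ι) (l : List ι) (f : (ι → Bool) → ℝ) :
    avg w i (avgList w l f) = avgList w l (avg w i f) := by
  induction l with
  | nil => rfl
  | cons k l ih =>
    change avg w i (avg w k (avgList w l f)) = avg w k (avgList w l (avg w i f))
    rw [avg_comm, ih]

lemma avgList_sub (w : ι → ℝ) (l : List ι) (f g : (ι → Bool) → ℝ) :
    avgList w l (f - g) = avgList w l f - avgList w l g := by
  induction l with
  | nil => rfl
  | cons k l ih =>
    change avg w k (avgList w l (f - g)) = avg w k (avgList w l f) - avg w k (avgList w l g)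
    rw [ih, avg_sub]

lemma avg_update (w : ι → ℝ) (i : ι) (f : (ι → Bool) → ℝ) (x : ι → Bool) (b : Bool) :
    avg w i f (Function.update x i b) = avg w i f x := by
  simp [avg]

lemma avgList_update_of_mem (w : ι → ℝ) {i : ι} {l : List ι} (hi : i ∈ l)
    (f : (ι → Bool) → ℝ) (x : ι → Bool) (b : Bool) :
    avgList w l f (Function.update x i b) = avgList w l f x := by
  induction l generalizing x with
  | nil => simp at hi
  | cons k l ih =>
    change avg w k (avgList w l f) _ = avg w k (avgList w l f) _
    by_cases h : i = k
    · rw [h, avg_update]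
    · have := ih (by simpa [h] using hi)
      simp only [avg, Function.update_comm h, this]

end Averages

section LogSobolev

variable {ι : Type*} [Fintype ι] [DecidableEq ι]

lemma ex_avgList (w : ι → ℝ) (l : List ι) (f : (ι → Bool) → ℝ) :
    ex w (avgList w l f) = ex w f := by
  induction l with
  | nil => rfl
  | cons k l ih => exact (ex_avg w k _).trans ih

/-- Once every coordinate is averaged out the function is constant, and averaging preserves the
expectation. -/
lemma avgList_toList (w : ι → ℝ) (f : (ι → Bool) → ℝ) (x : ι → Bool) :
    avgList w Finset.univ.toList f x = ex w f := by
  have h : ∀ y (s : Finset ι), avgList w Finset.univ.toList f (s.piecewise y x) =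
      avgList w Finset.univ.toList f x := by
    intro y s
    induction s using Finset.induction_on with
    | empty => simp
    | insert i s _ ih =>
      rw [Finset.piecewise_insert, avgList_update_of_mem w (by simp), ih]
  have h2 : avgList w Finset.univ.toList f = fun _ => avgList w Finset.univ.toList f x := by
    funext y
    simpa using h y Finset.univ
  have h3 := ex_avgList w Finset.univ.toList f
  rw [h2, ex_const] at h3
  exact h3

/-- The Dirichlet form of the coordinate `i` evaluated at the square root of `F`. -/
noncomputable def sqrtForm (w : ι → ℝ) (i : ι) (F : (ι → Bool) → ℝ) : ℝ :=
  ex w fun x => w i * (1 - w i) *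
    (√(F (Function.update x i true)) - √(F (Function.update x i false))) ^ 2

lemma sqrtForm_avg_le {w : ι → ℝ} (h0 : ∀ i, 0 ≤ w i) (h1 : ∀ i, w i ≤ 1) (i k : ι)
    {F : (ι → Bool) → ℝ} (hF : ∀ x, 0 ≤ F x) :
    sqrtForm w i (avg w k F) ≤ sqrtForm w i F := by
  have h1' : ∀ i, 0 ≤ 1 - w i := fun i => by linarith [h1 i]
  unfold sqrtForm
  by_cases h : i = k
  · subst h
    refine ex_mono h0 h1 fun x => ?_
    simp only [avg_update, sub_self]
    have := h0 i
    have := h1' i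
    have : 0 ≤ w i * (1 - w i) *
      (√(F (Function.update x i true)) - √(F (Function.update x i false))) ^ 2 := by positivity
    simpa using this
  · rw [← ex_avg w k (fun x => w i * (1 - w i) *
      (√(F (Function.update x i true)) - √(F (Function.update x i false))) ^ 2)]
    refine ex_mono h0 h1 fun x => ?_
    have := sq_sqrt_sub_sqrt_le (h0 k) (h1' k)
      (hF (Function.update (Function.update x i true) k true))
      (hF (Function.update (Function.update x i true) k false))
      (hF (Function.update (Function.update x i false) k true))
      (hF (Function.update (Function.update x i false) k false))
    refine (mul_le_mul_of_nonneg_left this (mul_nonneg (h0 i) (h1' i))).trans_eq ?_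
    simp only [avg, Function.update_comm h]
    ring

lemma sqrtForm_avgList_le {w : ι → ℝ} (h0 : ∀ i, 0 ≤ w i) (h1 : ∀ i, w i ≤ 1) (i : ι)
    (l : List ι) {F : (ι → Bool) → ℝ} (hF : ∀ x, 0 ≤ F x) :
    sqrtForm w i (avgList w l F) ≤ sqrtForm w i F := by
  induction l with
  | nil => rfl
  | cons k l ih =>
    exact (sqrtForm_avg_le h0 h1 i k (avgList_nonneg h0 h1 l hF)).trans ih

/-- Tensorisation: the entropy telescopes along the list, each drop is a two-point entropy, and
averaging over the other coordinates only decreases `sqrtForm`. -/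
lemma entropy_avgList_le {w : ι → ℝ} {m : ℝ} (hm : 0 < m) (h0 : ∀ i, m ≤ w i)
    (h1 : ∀ i, m ≤ 1 - w i) (l : List ι) {F : (ι → Bool) → ℝ} (hF : ∀ x, 0 ≤ F x) :
    ex w (fun x => F x * Real.log (F x)) -
      ex w (fun x => avgList w l F x * Real.log (avgList w l F x)) ≤
      2 / m * (l.map fun i => sqrtForm w i F).sum := by
  have h0' : ∀ i, 0 ≤ w i := fun i => hm.le.trans (h0 i)
  have h1' : ∀ i, w i ≤ 1 := fun i => by linarith [h1 i]
  induction l with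
  | nil => simp [avgList]
  | cons i l ih =>
    set H := avgList w l F with hH
    have hHn : ∀ x, 0 ≤ H x := avgList_nonneg h0' h1' l hF
    have step : ex w (fun x => H x * Real.log (H x)) -
        ex w (fun x => avg w i H x * Real.log (avg w i H x)) ≤ 2 / m * sqrtForm w i H := by
      rw [← ex_avg w i (fun x => H x * Real.log (H x)), ← ex_sub, sqrtForm, ← ex_const_mul]
      exact ex_mono h0' h1' fun x => mul_log_two_point_le hm (h0 i) (h1 i) (hHn _) (hHn _)
    have h2 := sqrtForm_avgList_le h0' h1' i l hF
    have h3 : 2 / m * sqrtForm w i H ≤ 2 / m * sqrtForm w i F :=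
      mul_le_mul_of_nonneg_left h2 (by positivity)
    rw [List.map_cons, List.sum_cons, mul_add]
    change _ - ex w (fun x => avg w i H x * Real.log (avg w i H x)) ≤ _
    linarith

/-- The Dirichlet form of the product measure with marginals `w`. -/
def energy (w : ι → ℝ) (f : (ι → Bool) → ℝ) : ℝ :=
  ∑ i, ex w fun x => (f x - avg w i f x) ^ 2

lemma ex_sq_sub_avg (w : ι → ℝ) (i : ι) (f : (ι → Bool) → ℝ) :
    ex w (fun x => (f x - avg w i f x) ^ 2) = ex w (fun x => w i * (1 - w i) *
      (f (Function.update x i true) - f (Function.update x i false)) ^ 2) := by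
  rw [← ex_avg w i]
  congr 1
  funext x
  simp only [avg, Function.update_idem]
  ring

/-- The logarithmic Sobolev inequality for the product measure with marginals `w`. -/
lemma entropy_sq_le {w : ι → ℝ} {m : ℝ} (hm : 0 < m) (h0 : ∀ i, m ≤ w i)
    (h1 : ∀ i, m ≤ 1 - w i) (g : (ι → Bool) → ℝ) :
    ex w (fun x => g x ^ 2 * Real.log (g x ^ 2)) -
      ex w (fun x => g x ^ 2) * Real.log (ex w (fun x => g x ^ 2)) ≤ 2 / m * energy w g := by
  have h0' : ∀ i, 0 ≤ w i := fun i => hm.le.trans (h0 i)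
  have h1' : ∀ i, w i ≤ 1 := fun i => by linarith [h1 i]
  have h := entropy_avgList_le hm h0 h1 Finset.univ.toList (F := fun x => g x ^ 2)
    (fun x => sq_nonneg _)
  simp only [avgList_toList, ex_const] at h
  refine h.trans (mul_le_mul_of_nonneg_left ?_ (by positivity))
  rw [Finset.sum_map_toList]
  refine Finset.sum_le_sum fun i _ => ?_
  rw [ex_sq_sub_avg]
  refine ex_mono h0' h1' fun x => mul_le_mul_of_nonneg_left ?_
    (mul_nonneg (h0' i) (by linarith [h1' i]))
  simp only [Real.sqrt_sq_eq_abs]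
  exact sq_le_sq.2 (abs_abs_sub_abs_le _ _)

/-- Averages commute, so Pythagoras in direction `i` applies to each difference `g - avg w k g`. -/
lemma energy_eq_add (w : ι → ℝ) (i : ι) (g : (ι → Bool) → ℝ) :
    energy w g = energy w (avg w i g) + energy w (g - avg w i g) := by
  unfold energy
  rw [← Finset.sum_add_distrib]
  refine Finset.sum_congr rfl fun k _ => ?_
  have := ex_sq_eq_avg w i (g - avg w k g)
  simp only [avg_sub, Pi.sub_apply] at this ⊢
  rw [this, avg_comm w i k]
  congr 2
  funext x
  ring

lemma ex_abs_avgList_le {w : ι → ℝ} (h0 : ∀ i, 0 ≤ w i) (h1 : ∀ i, w i ≤ 1) (l : List ι)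
    (f : (ι → Bool) → ℝ) : ex w (fun x => |avgList w l f x|) ≤ ex w (fun x => |f x|) := by
  induction l with
  | nil => rfl
  | cons k l ih =>
    refine (ex_mono h0 h1 fun x => abs_avg_le h0 h1 k (avgList w l f) x).trans ?_
    rw [ex_avg]
    exact ih

lemma neg_two_mul_le_sq_mul_log {y : ℝ} (hy : 0 ≤ y) : -(2 * y) ≤ y ^ 2 * Real.log (y ^ 2) := by
  rcases hy.eq_or_lt with rfl | hy
  · simp
  · rw [Real.log_pow]
    have := Real.one_sub_inv_le_log_of_pos hy
    have h2 := mul_le_mul_of_nonneg_left this (by positivity : 0 ≤ 2 * y ^ 2)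
    have e : 2 * y ^ 2 * (1 - y⁻¹) = 2 * y ^ 2 - 2 * y := by field_simp
    push_cast
    nlinarith [sq_nonneg y]

/-- A small L¹ norm forces a large entropy of d²: v = E d² ≤ E|d| ≤ J gives -v log v ≥ v log(1/J),
while y² log y² ≥ -2y costs at most 2J. -/
lemma mul_log_inv_le_energy {w : ι → ℝ} {m J : ℝ} (hm : 0 < m) (h0 : ∀ i, m ≤ w i)
    (h1 : ∀ i, m ≤ 1 - w i) {d : (ι → Bool) → ℝ} (hd : ∀ x, |d x| ≤ 1)
    (hdJ : ex w (fun x => |d x|) ≤ J) :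
    Real.log (1 / J) * ex w (fun x => d x ^ 2) - 2 * J ≤ 2 / m * energy w d := by
  have h0' : ∀ i, 0 ≤ w i := fun i => hm.le.trans (h0 i)
  have h1' : ∀ i, w i ≤ 1 := fun i => by linarith [h1 i]
  refine le_trans ?_ (entropy_sq_le hm h0 h1 d)
  set v := ex w (fun x => d x ^ 2) with hv
  have hvn : 0 ≤ v := ex_nonneg h0' h1' fun x => sq_nonneg _
  have hvJ : v ≤ J := by
    refine (ex_mono h0' h1' fun x => ?_).trans hdJ
    rw [← sq_abs]
    nlinarith [abs_nonneg (d x), hd x]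
  have e1 : -(2 * J) ≤ ex w (fun x => d x ^ 2 * Real.log (d x ^ 2)) := by
    have : ex w (fun x => (-2) * |d x|) ≤ ex w (fun x => d x ^ 2 * Real.log (d x ^ 2)) := by
      refine ex_mono h0' h1' fun x => ?_
      rw [← sq_abs]
      linarith [neg_two_mul_le_sq_mul_log (abs_nonneg (d x))]
    rw [ex_const_mul] at this
    linarith
  have e2 : v * Real.log v ≤ v * Real.log J := by
    rcases hvn.eq_or_lt with h | h
    · simp [← h]
    · exact mul_le_mul_of_nonneg_left (Real.log_le_log h hvJ) hvn
  rw [one_div, Real.log_inv]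
  linarith

/-- Averaging out `i` removes the martingale difference `avgList w l (f - avg w i f)`, whose L¹ norm
is at most J because averages contract L¹. Second moment and energy both split orthogonally, so the
bounds for the single differences add up. -/
lemma falik_samorodnitsky_avgList {w : ι → ℝ} {m J : ℝ} (hm : 0 < m) (h0 : ∀ i, m ≤ w i)
    (h1 : ∀ i, m ≤ 1 - w i) {f : (ι → Bool) → ℝ}
    (hf : ∀ x, f x ∈ Set.Icc (0 : ℝ) 1)
    (hfJ : ∀ i, ex w (fun x => |f x - avg w i f x|) ≤ J) (l : List ι) :
    Real.log (1 / J) * (ex w (fun x => f x ^ 2) - ex w (fun x => avgList w l f x ^ 2)) -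
      2 * l.length * J ≤ 2 / m * (energy w f - energy w (avgList w l f)) := by
  have h0' : ∀ i, 0 ≤ w i := fun i => hm.le.trans (h0 i)
  have h1' : ∀ i, w i ≤ 1 := fun i => by linarith [h1 i]
  induction l with
  | nil => simp [avgList]
  | cons i l ih =>
    change Real.log (1 / J) * (ex w (fun x => f x ^ 2) -
      ex w (fun x => avg w i (avgList w l f) x ^ 2)) -
      2 * (i :: l).length * J ≤ 2 / m * (energy w f - energy w (avg w i (avgList w l f)))
    set g := avgList w l f with hg
    have hgm : ∀ x, g x ∈ Set.Icc (0 : ℝ) 1 := avgList_mem_Icc h0' h1' l hf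
    have hd : g - avg w i g = avgList w l (f - avg w i f) := by
      rw [avgList_sub, ← avg_avgList]
    have h2 := mul_log_inv_le_energy (J := J) hm h0 h1 (d := g - avg w i g)
      (fun x => by
        have a := hgm x
        have b := avg_mem_Icc h0' h1' i hgm x
        rw [Pi.sub_apply, abs_le]
        constructor <;> linarith [a.1, a.2, b.1, b.2])
      (by
        rw [hd]
        exact (ex_abs_avgList_le h0' h1' l _).trans (hfJ i))
    have h3 := ex_sq_eq_avg w i g
    have h4 := energy_eq_add w i g
    simp only [Pi.sub_apply] at h2
    rw [h3] at ih
    rw [h4] at ih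
    push_cast [List.length_cons]
    nlinarith

/-- A function with values in the unit interval, all of whose influences are small, has
large energy compared to its variance. -/
lemma falik_samorodnitsky {w : ι → ℝ} {m J : ℝ} (hm : 0 < m) (h0 : ∀ i, m ≤ w i)
    (h1 : ∀ i, m ≤ 1 - w i) {f : (ι → Bool) → ℝ}
    (hf : ∀ x, f x ∈ Set.Icc (0 : ℝ) 1)
    (hfJ : ∀ i, ex w (fun x => |f x - avg w i f x|) ≤ J) :
    Real.log (1 / J) * (ex w (fun x => f x ^ 2) - ex w f ^ 2) - 2 * Fintype.card ι * J ≤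
      2 / m * energy w f := by
  have h0' : ∀ i, 0 ≤ w i := fun i => hm.le.trans (h0 i)
  have h1' : ∀ i, w i ≤ 1 := fun i => by linarith [h1 i]
  have h := falik_samorodnitsky_avgList hm h0 h1 hf hfJ Finset.univ.toList
  simp only [avgList_toList, ex_const, Finset.length_toList, Finset.card_univ] at h
  refine h.trans (mul_le_mul_of_nonneg_left ?_ (by positivity))
  have : 0 ≤ energy w (avgList w Finset.univ.toList f) :=
    Finset.sum_nonneg fun i _ => ex_nonneg h0' h1' fun x => sq_nonneg _
  linarith

end LogSobolev

/-! ### Monotone functions under a uniform bias. -/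

variable {ι : Type*} [Fintype ι] [DecidableEq ι]

lemma ex_diag_monotoneOn {f : (ι → Bool) → ℝ}
    (hf : ∀ x i, f (Function.update x i false) ≤ f (Function.update x i true)) :
    MonotoneOn (fun t => ex (fun _ => t) f) (Set.Icc 0 1) := by
  refine monotoneOn_of_deriv_nonneg (convex_Icc 0 1)
    (fun t _ => (hasDerivAt_ex f t).continuousAt.continuousWithinAt)
    (fun t _ => (hasDerivAt_ex f t).differentiableAt.differentiableWithinAt) fun t ht => ?_
  rw [interior_Icc] at ht
  rw [(hasDerivAt_ex f t).deriv]
  exact Finset.sum_nonneg fun i _ =>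
    ex_nonneg (fun _ => ht.1.le) (fun _ => ht.2.le) fun x => sub_nonneg.2 (hf x i)

lemma energy_le_sum {t : ℝ} (h0 : 0 ≤ t) (h1 : t ≤ 1) {f : (ι → Bool) → ℝ}
    (hf : ∀ x i, f (Function.update x i true) - f (Function.update x i false) ∈
      Set.Icc (0 : ℝ) 1) :
    energy (fun _ => t) f ≤ ∑ i, ex (fun _ => t) (fun x =>
      f (Function.update x i true) - f (Function.update x i false)) := by
  refine Finset.sum_le_sum fun i _ => ?_
  rw [ex_sq_sub_avg]
  refine ex_mono (fun _ => h0) (fun _ => h1) fun x => ?_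
  obtain ⟨a, b⟩ := hf x i
  have h2 : t * (1 - t) ≤ 1 := by nlinarith
  have h3 : 0 ≤ t * (1 - t) := mul_nonneg h0 (by linarith)
  nlinarith

lemma ex_abs_sub_avg_le {t : ℝ} (h0 : 0 ≤ t) (h1 : t ≤ 1) {f : (ι → Bool) → ℝ} (i : ι)
    (hf : ∀ x, f (Function.update x i false) ≤ f (Function.update x i true)) :
    ex (fun _ => t) (fun x => |f x - avg (fun _ => t) i f x|) ≤ ex (fun _ => t) (fun x =>
      f (Function.update x i true) - f (Function.update x i false)) := by
  rw [← ex_avg (fun _ => t) i (fun x => |f x - avg (fun _ => t) i f x|)]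
  refine ex_mono (fun _ => h0) (fun _ => h1) fun x => ?_
  have h := sub_nonneg.2 (hf x)
  set D := f (Function.update x i true) - f (Function.update x i false) with hD
  have e1 : f (Function.update x i true) - avg (fun _ => t) i f (Function.update x i true) =
      (1 - t) * D := by
    rw [avg_update]; simp only [avg]; rw [hD]; ring
  have e2 : f (Function.update x i false) - avg (fun _ => t) i f (Function.update x i false) =
      -(t * D) := by
    rw [avg_update]; simp only [avg]; rw [hD]; ring
  rw [avg, e1, e2, abs_neg, abs_of_nonneg (mul_nonneg (by linarith) h),
    abs_of_nonneg (mul_nonneg h0 h)]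
  nlinarith [mul_nonneg (mul_nonneg h0 (by linarith : 0 ≤ 1 - t)) h,
    mul_nonneg (add_nonneg (sq_nonneg t) (sq_nonneg (1 - t))) h]

end BiasedCube

/-! ### Subcodes supported in a random set, and their mean dimension. -/

namespace BinaryLinearCode

open BiasedCube

variable {n : ℕ}

/-- The subcode of the codewords supported in `{i | x i = true}`. -/
def supportedIn (C : BinaryLinearCode n) (x : Fin n → Bool) : BinaryLinearCode n where
  carrier := {y | y ∈ C ∧ ∀ i, x i = false → y i = 0}
  add_mem' := fun {a b} ha hb =>
    ⟨C.add_mem ha.1 hb.1, fun i hi => by simp [ha.2 i hi, hb.2 i hi]⟩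
  zero_mem' := ⟨C.zero_mem, fun _ _ => rfl⟩
  smul_mem' := fun c a ha => ⟨C.smul_mem c ha.1, fun i hi => by simp [ha.2 i hi]⟩

lemma mem_supportedIn {C : BinaryLinearCode n} {x : Fin n → Bool} {y : Fin n → ZMod 2} :
    y ∈ C.supportedIn x ↔ y ∈ C ∧ ∀ i, x i = false → y i = 0 := Iff.rfl

/-- The dimension of the subcode supported in a set of coordinates. -/
noncomputable def suppDim (C : BinaryLinearCode n) (x : Fin n → Bool) : ℝ :=
  Module.finrank (ZMod 2) (C.supportedIn x)

/-- If all coordinates outside `{j | x j = true} ∪ {i}` of a codeword vanish, the `i`-th one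
is not determined. -/
def IsFree (C : BinaryLinearCode n) (i : Fin n) (x : Fin n → Bool) : Prop :=
  ∃ y ∈ C, (∀ j, j ≠ i → x j = false → y j = 0) ∧ y i ≠ 0

open Classical in
/-- The indicator function of `IsFree`. -/
noncomputable def freeInd (C : BinaryLinearCode n) (i : Fin n) (x : Fin n → Bool) : ℝ :=
  if C.IsFree i x then 1 else 0

lemma freeInd_mem_Icc (C : BinaryLinearCode n) (i : Fin n) (x : Fin n → Bool) :
    C.freeInd i x ∈ Set.Icc (0 : ℝ) 1 := by
  unfold freeInd
  split_ifs <;> simp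

lemma freeInd_congr {C : BinaryLinearCode n} {i i' : Fin n} {x x' : Fin n → Bool}
    (h : C.IsFree i x ↔ C.IsFree i' x') : C.freeInd i x = C.freeInd i' x' := by
  unfold freeInd
  split_ifs with h1 h2 h2
  · rfl
  · exact absurd (h.1 h1) h2
  · exact absurd (h.2 h2) h1
  · rfl

lemma freeInd_sq (C : BinaryLinearCode n) (i : Fin n) (x : Fin n → Bool) :
    C.freeInd i x ^ 2 = C.freeInd i x := by
  unfold freeInd
  split_ifs <;> simp

lemma freeInd_mono (C : BinaryLinearCode n) (i : Fin n) {x x' : Fin n → Bool}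
    (h : ∀ j, x' j = false → x j = false) : C.freeInd i x ≤ C.freeInd i x' := by
  unfold freeInd
  split_ifs with h1 h2
  · rfl
  · obtain ⟨y, hy, h3, h4⟩ := h1
    exact absurd ⟨y, hy, fun j hj hx => h3 j hj (h j hx), h4⟩ h2
  · norm_num
  · rfl

lemma freeInd_update_mono (C : BinaryLinearCode n) (i j : Fin n) (x : Fin n → Bool) :
    C.freeInd i (Function.update x j false) ≤ C.freeInd i (Function.update x j true) := by
  refine C.freeInd_mono i fun k hk => ?_
  by_cases h : k = j
  · subst h; simp
  · simpa [h] using hk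

lemma freeInd_update_self (C : BinaryLinearCode n) (i : Fin n) (x : Fin n → Bool) (b : Bool) :
    C.freeInd i (Function.update x i b) = C.freeInd i x := by
  have : C.IsFree i (Function.update x i b) ↔ C.IsFree i x := by
    unfold IsFree
    refine exists_congr fun y => and_congr_right fun _ => and_congr_left fun _ =>
      forall_congr' fun j => forall_congr' fun hj => ?_
    rw [Function.update_of_ne hj]
  exact freeInd_congr this

/-- Rank–nullity for the `i`-th coordinate functional on the larger subcode: its kernel is the
smaller subcode, and its range is nonzero exactly when `i` is free. -/
lemma suppDim_update_true (C : BinaryLinearCode n) (i : Fin n) (x : Fin n → Bool) :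
    C.suppDim (Function.update x i true) =
      C.suppDim (Function.update x i false) + C.freeInd i x := by
  set A := C.supportedIn (Function.update x i true) with hA
  let φ : A →ₗ[ZMod 2] ZMod 2 := (LinearMap.proj i).domRestrict A
  have hker : φ.ker.map A.subtype = C.supportedIn (Function.update x i false) := by
    ext y
    simp only [Submodule.mem_map, LinearMap.mem_ker, Submodule.subtype_apply, mem_supportedIn]
    constructor
    · rintro ⟨⟨z, hz⟩, h1, rfl⟩
      refine ⟨hz.1, fun j hj => ?_⟩
      by_cases h : j = i
      · subst h; exact h1
      · exact hz.2 j (by simpa [h] using hj)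
    · rintro ⟨h1, h2⟩
      refine ⟨⟨y, h1, fun j hj => h2 j ?_⟩, h2 i (by simp), rfl⟩
      by_cases h : j = i
      · subst h; simp
      · simpa [h] using hj
  have h1 := LinearMap.finrank_range_add_finrank_ker φ
  rw [← Submodule.finrank_map_subtype_eq, hker] at h1
  have h2 : (Module.finrank (ZMod 2) φ.range : ℝ) = C.freeInd i x := by
    unfold freeInd
    split_ifs with h
    · obtain ⟨y, hy, h3, h4⟩ := h
      have hy' : y ∈ A := ⟨hy, fun j hj => h3 j (by rintro rfl; simp at hj) (by
        by_cases h : j = i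
        · subst h; simp at hj
        · simpa [h] using hj)⟩
      have : φ.range = ⊤ := by
        rw [LinearMap.range_eq_top]
        intro c
        refine ⟨(c * (y i)⁻¹) • ⟨y, hy'⟩, ?_⟩
        have : φ ⟨y, hy'⟩ = y i := rfl
        rw [map_smul, this, smul_eq_mul, mul_assoc, inv_mul_cancel₀ h4, mul_one]
      rw [this]
      simp
    · have : φ.range = ⊥ := by
        rw [LinearMap.range_eq_bot]
        ext ⟨y, hy⟩
        by_contra h4
        refine h ⟨y, hy.1, fun j hj hx => hy.2 j ?_, h4⟩
        simpa [hj] using hx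
      rw [this]
      simp
  unfold suppDim
  rw [← h2, add_comm, ← Nat.cast_add, h1]

lemma suppDim_nonneg (C : BinaryLinearCode n) (x : Fin n → Bool) : 0 ≤ C.suppDim x :=
  Nat.cast_nonneg _

lemma suppDim_update_mono (C : BinaryLinearCode n) (x : Fin n → Bool) (i : Fin n) :
    C.suppDim (Function.update x i false) ≤ C.suppDim (Function.update x i true) := by
  rw [suppDim_update_true]
  linarith [(C.freeInd_mem_Icc i x).1]

lemma finrank_le_length (C : BinaryLinearCode n) : Module.finrank (ZMod 2) C ≤ n := by
  simpa using Submodule.finrank_le C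

lemma suppDim_true (C : BinaryLinearCode n) :
    C.suppDim (fun _ => true) = Module.finrank (ZMod 2) C := by
  have : C.supportedIn (fun _ => true) = C := by
    ext y
    simp [mem_supportedIn]
  rw [suppDim, this]

lemma suppDim_false (C : BinaryLinearCode n) : C.suppDim (fun _ => false) = 0 := by
  have : C.supportedIn (fun _ => false) = ⊥ := by
    ext y
    simp only [mem_supportedIn, Submodule.mem_bot]
    constructor
    · exact fun h => funext fun i => h.2 i trivial
    · rintro rfl; exact ⟨C.zero_mem, fun _ _ => rfl⟩
  rw [suppDim, this]
  simp

/-- The expected dimension of the subcode supported in a random set of coordinates. -/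
noncomputable def meanDim (C : BinaryLinearCode n) (t : ℝ) : ℝ :=
  ex (fun _ => t) C.suppDim

lemma meanDim_one (C : BinaryLinearCode n) : C.meanDim 1 = Module.finrank (ZMod 2) C := by
  have := ex_vertex (fun _ : Fin n => true) C.suppDim
  simpa [meanDim, suppDim_true] using this

lemma meanDim_zero (C : BinaryLinearCode n) : C.meanDim 0 = 0 := by
  have := ex_vertex (fun _ : Fin n => false) C.suppDim
  simpa [meanDim, suppDim_false] using this

lemma hasDerivAt_meanDim (C : BinaryLinearCode n) (t : ℝ) :
    HasDerivAt C.meanDim (∑ i, ex (fun _ => t) (C.freeInd i)) t := by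
  have := hasDerivAt_ex C.suppDim t
  simp only [suppDim_update_true, add_sub_cancel_left] at this
  exact this

lemma freeInd_comp_perm (C : BinaryLinearCode n) {π : Equiv.Perm (Fin n)}
    (hπ : π ∈ C.autGroup) (i : Fin n) (x : Fin n → Bool) :
    C.freeInd i (x ∘ π) = C.freeInd (π i) x := by
  have hπ' : ∀ y : Fin n → ZMod 2, (fun j => y (π j)) ∈ C ↔ y ∈ C := hπ
  have : C.IsFree i (x ∘ π) ↔ C.IsFree (π i) x := by
    constructor
    · rintro ⟨y, hy, h1, h2⟩
      refine ⟨fun j => y (π.symm j), (hπ' _).1 (by simpa using hy), fun j hj hx => ?_, by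
        simpa using h2⟩
      exact h1 _ (fun h => hj (by rw [← h]; simp)) (by simpa using hx)
    · rintro ⟨y, hy, h1, h2⟩
      exact ⟨fun j => y (π j), (hπ' y).2 hy,
        fun j hj hx => h1 _ (fun h => hj (π.injective h)) hx, h2⟩
  exact freeInd_congr this

/-! ### Double transitivity and the sharp threshold. -/

/-- The influence of the coordinate `j` on the coordinate `i`. -/
noncomputable def influence (C : BinaryLinearCode n) (t : ℝ) (i j : Fin n) : ℝ :=
  ex (fun _ => t) fun x =>
    C.freeInd i (Function.update x j true) - C.freeInd i (Function.update x j false)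

lemma IsDoublyTransitive.exists_perm {C : BinaryLinearCode n} (hC : C.IsDoublyTransitive)
    {i j i' j' : Fin n} (h : i ≠ j) (h' : i' ≠ j') :
    ∃ π ∈ C.autGroup, π i = i' ∧ π j = j' := by
  obtain ⟨⟨π, hπ⟩, h1, h2⟩ := MulAction.is_two_pretransitive_iff.1 hC h h'
  exact ⟨π, hπ, h1, h2⟩

lemma IsDoublyTransitive.ex_freeInd_eq {C : BinaryLinearCode n} (hC : C.IsDoublyTransitive)
    (t : ℝ) (i i' : Fin n) :
    ex (fun _ => t) (C.freeInd i) = ex (fun _ => t) (C.freeInd i') := by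
  by_cases h : i = i'
  · rw [h]
  obtain ⟨π, hπ, h1, -⟩ := hC.exists_perm h (Ne.symm h)
  rw [← ex_comp_perm t π]
  congr 1
  funext x
  rw [freeInd_comp_perm C hπ, h1]

lemma IsDoublyTransitive.influence_eq {C : BinaryLinearCode n} (hC : C.IsDoublyTransitive)
    (t : ℝ) {i j i' j' : Fin n} (h : i ≠ j) (h' : i' ≠ j') :
    C.influence t i j = C.influence t i' j' := by
  obtain ⟨π, hπ, h1, h2⟩ := hC.exists_perm h h'
  unfold influence
  rw [← ex_comp_perm t π]
  congr 1
  funext x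
  have : ∀ b, Function.update (x ∘ π) j b = Function.update x j' b ∘ π := by
    intro b
    rw [← h2, Function.update_comp_equiv]
    simp
  rw [this, this, freeInd_comp_perm C hπ, freeInd_comp_perm C hπ, h1]

lemma influence_self (C : BinaryLinearCode n) (t : ℝ) (i : Fin n) : C.influence t i i = 0 := by
  simp only [influence, freeInd_update_self, sub_self, ex_const]

/-- A quantitative sharp threshold: a code whose mean dimension at `1 - R` is linear in the
length has bounded length. -/
lemma IsDoublyTransitive.log_le_of_lt_meanDim {C : BinaryLinearCode n}
    (hC : C.IsDoublyTransitive) (hn : 2 ≤ n) {δ : ℝ} (hδ : 0 < δ)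
    (h : δ * n < C.meanDim (1 - C.rate)) (hlog : 0 ≤ Real.log ((n - 1) * δ / 2)) :
    Real.log ((n - 1) * δ / 2) * (δ / 2 * δ) ≤ 8 / δ ^ 2 + 8 / δ := by
  have hn0 : (0 : ℝ) < n := by positivity
  have hn1 : (1 : ℝ) ≤ n - 1 := by
    have : (2 : ℝ) ≤ n := by exact_mod_cast hn
    linarith
  set k : ℝ := ((Module.finrank (ZMod 2) C : ℕ) : ℝ) with hk
  have hk0 : 0 ≤ k := Nat.cast_nonneg _
  have hkn : k ≤ n := Nat.cast_le.2 C.finrank_le_length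
  set s := 1 - C.rate with hs
  have hR : C.rate = k / n := rfl
  have hs0 : 0 ≤ s := by rw [hs, hR, sub_nonneg, div_le_one hn0]; exact hkn
  have hs1 : s ≤ 1 := by rw [hs, hR]; linarith [div_nonneg hk0 hn0.le]
  have hks : k = (1 - s) * n := by rw [hs, hR]; field_simp; ring
  let i₀ : Fin n := ⟨0, by omega⟩
  set D := C.meanDim
  set p : ℝ → ℝ := fun t => ex (fun _ => t) (C.freeInd i₀) with hp
  have hD' : ∀ t, HasDerivAt D (n * p t) t := by
    intro t
    refine (C.hasDerivAt_meanDim t).congr_deriv ?_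
    rw [Finset.sum_congr rfl fun i _ => hC.ex_freeInd_eq t i i₀]
    simp [hp]
  have hp' : ∀ t, HasDerivAt p (∑ j, C.influence t i₀ j) t := fun t => hasDerivAt_ex _ t
  have hp01 : ∀ t ∈ Set.Icc (0 : ℝ) 1, p t ∈ Set.Icc (0 : ℝ) 1 := by
    intro t ht
    refine ⟨ex_nonneg (fun _ => ht.1) (fun _ => ht.2) fun x => (C.freeInd_mem_Icc i₀ x).1, ?_⟩
    rw [← ex_const (fun _ : Fin n => t) 1]
    exact ex_mono (fun _ => ht.1) (fun _ => ht.2) fun x => (C.freeInd_mem_Icc i₀ x).2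
  have hpm : MonotoneOn p (Set.Icc 0 1) :=
    ex_diag_monotoneOn fun x j => C.freeInd_update_mono i₀ j x
  have hD0 : D 0 = 0 := C.meanDim_zero
  have hD1 : D 1 = k := C.meanDim_one
  have mvt : ∀ a b, a < b → ∃ c ∈ Set.Ioo a b, D b - D a = (b - a) * (n * p c) := by
    intro a b hab
    obtain ⟨c, hc, h⟩ := exists_hasDerivAt_eq_slope D (fun t => n * p t) hab
      (fun t _ => (hD' t).continuousAt.continuousWithinAt) fun t _ => hD' t
    refine ⟨c, hc, ?_⟩
    have : b - a ≠ 0 := by linarith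
    rw [h]; field_simp
  have hδn : 0 < δ * n := mul_pos hδ hn0
  have hspos : 0 < s := by
    rcases hs0.eq_or_lt with h0 | h0
    · rw [← h0, hD0] at h; linarith
    · exact h0
  have hs1' : s < 1 := by
    rcases hs1.eq_or_lt with h0 | h0
    · rw [h0, hD1, hks, h0] at h; linarith
    · exact h0
  -- Together with `hδ1s` this keeps the window [s - δ/2, s] at distance at least δ/2 from 0 and 1,
  -- as the logarithmic Sobolev constant requires.
  have hδs : δ < s := by
    obtain ⟨c, hc, e⟩ := mvt 0 s hspos
    have hpc := (hp01 c ⟨hc.1.le, by linarith [hc.2]⟩).2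
    have : s * (n * p c) ≤ s * n :=
      mul_le_mul_of_nonneg_left (by nlinarith) hs0
    refine lt_of_mul_lt_mul_right ?_ hn0.le
    linarith
  -- The choice s = 1 - R enters here: as p is increasing, D(1) - D(s) is at least (1 - s) n p(s),
  -- which is k p(s).
  have hupper : D s ≤ k * (1 - p s) := by
    obtain ⟨c, hc, e⟩ := mvt s 1 hs1'
    have hpc := hpm ⟨hs0, hs1⟩ ⟨by linarith [hc.1], hc.2.le⟩ hc.1.le
    have : k * p s ≤ k * p c := mul_le_mul_of_nonneg_left hpc hk0
    have e2 : (1 - s) * (n * p c) = k * p c := by rw [hks]; ring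
    linarith
  have hps := hp01 s ⟨hs0, hs1⟩
  have hps1 : δ ≤ 1 - p s := by
    have : k * (1 - p s) ≤ n * (1 - p s) := mul_le_mul_of_nonneg_right hkn (by linarith [hps.2])
    refine le_of_mul_le_mul_right ?_ hn0
    linarith
  have hδ1s : δ ≤ 1 - s := by
    have : k * (1 - p s) ≤ k * 1 := mul_le_mul_of_nonneg_left (by linarith [hps.1]) hk0
    refine le_of_mul_le_mul_right ?_ hn0
    linarith
  set a := s - δ / 2 with ha
  have ha0 : 0 < a := by linarith
  -- Over [a, s] the function D grows by at most δn/2, so D(a) ≥ δn/2; and D(a) ≤ n p(a) by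
  -- monotonicity of p.
  have hpa : δ / 2 ≤ p a := by
    obtain ⟨c, hc, e⟩ := mvt a s (by linarith)
    obtain ⟨c', hc', e'⟩ := mvt 0 a ha0
    have h1 := (hp01 c ⟨by linarith [hc.1], by linarith [hc.2]⟩).2
    have h2 := hpm (a := c') (b := a) ⟨hc'.1.le, by linarith [hc'.2]⟩
      ⟨ha0.le, by linarith⟩ hc'.2.le
    have h3 : (s - a) * (n * p c) ≤ (s - a) * n :=
      mul_le_mul_of_nonneg_left (by nlinarith) (by linarith)
    have h4 : (a - 0) * (n * p c') ≤ n * p a := by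
      have h5 : 0 ≤ p c' := (hp01 c' ⟨hc'.1.le, by linarith [hc'.2]⟩).1
      have h6 : (a - 0) * (n * p c') ≤ 1 * (n * p c') :=
        mul_le_mul_of_nonneg_right (by linarith) (by positivity)
      nlinarith
    have h7 : (s - a) * n = δ / 2 * n := by rw [ha]; ring
    refine le_of_mul_le_mul_right ?_ hn0
    linarith
  -- p rises by at most 1 over a window of length δ/2, so at some t the total influence is at most
  -- 2/δ.
  obtain ⟨t, ht, hslope⟩ := exists_hasDerivAt_eq_slope p (fun t => ∑ j, C.influence t i₀ j)
    (by linarith : a < s) (fun t _ => (hp' t).continuousAt.continuousWithinAt) fun t _ => hp' t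
  have ht0 : 0 ≤ t := by linarith [ht.1]
  have ht1 : t ≤ 1 := by linarith [ht.2]
  have hsum : ∑ j, C.influence t i₀ j ≤ 2 / δ := by
    have hpa0 := (hp01 a ⟨ha0.le, by linarith⟩).1
    have : s - a = δ / 2 := by rw [ha]; ring
    rw [hslope, this, div_le_div_iff₀ (by positivity) hδ]
    nlinarith [hps.2]
  have hpt1 : δ / 2 ≤ p t :=
    hpa.trans (hpm ⟨ha0.le, by linarith⟩ ⟨ht0, ht1⟩ ht.1.le)
  have hpt2 : δ ≤ 1 - p t := by
    linarith [hpm ⟨ht0, ht1⟩ ⟨hs0, hs1⟩ ht.2.le]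
  have hinf_nonneg : ∀ j, 0 ≤ C.influence t i₀ j := fun j =>
    ex_nonneg (fun _ => ht0) (fun _ => ht1) fun x => sub_nonneg.2 (C.freeInd_update_mono i₀ j x)
  -- The coordinate has no influence on itself, and the n - 1 other influences are equal.
  have hinf : ∀ j, C.influence t i₀ j ≤ 2 / δ / (n - 1) := by
    intro j
    by_cases hj : i₀ = j
    · rw [← hj, influence_self]; positivity
    · rw [le_div_iff₀ (by linarith)]
      refine le_trans (le_of_eq ?_) hsum
      rw [← Finset.add_sum_erase _ _ (Finset.mem_univ i₀), influence_self, zero_add,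
        Finset.sum_congr rfl fun j' hj' =>
          hC.influence_eq t (Finset.ne_of_mem_erase hj').symm hj]
      rw [Finset.sum_const, Finset.card_erase_of_mem (Finset.mem_univ _), Finset.card_univ,
        Fintype.card_fin, nsmul_eq_mul, Nat.cast_sub (by omega)]
      push_cast
      ring
  have key := falik_samorodnitsky (w := fun _ : Fin n => t) (m := δ / 2)
    (J := 2 / δ / (n - 1)) (by positivity) (fun _ => by linarith [ht.1])
    (fun _ => by linarith [ht.2]) (C.freeInd_mem_Icc i₀)
    fun j => (ex_abs_sub_avg_le ht0 ht1 j fun x => C.freeInd_update_mono i₀ j x).trans (hinf j)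
  have henergy : energy (fun _ : Fin n => t) (C.freeInd i₀) ≤ 2 / δ := by
    refine (energy_le_sum ht0 ht1 fun x j => ?_).trans hsum
    have h1 := C.freeInd_mem_Icc i₀ (Function.update x j true)
    have h2 := C.freeInd_mem_Icc i₀ (Function.update x j false)
    have h3 := C.freeInd_update_mono i₀ j x
    constructor <;> linarith [h1.2, h2.1]
  simp only [freeInd_sq, Fintype.card_fin] at key
  have e1 : 1 / (2 / δ / ((n : ℝ) - 1)) = (n - 1) * δ / 2 := by
    have : (n : ℝ) - 1 ≠ 0 := by linarith
    field_simp
  rw [e1] at key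
  change Real.log ((n - 1) * δ / 2) * (p t - p t ^ 2) - _ ≤ _ at key
  have h1 : δ / 2 * δ ≤ p t - p t ^ 2 := by
    have : p t - p t ^ 2 = p t * (1 - p t) := by ring
    rw [this]
    exact mul_le_mul hpt1 hpt2 hδ.le (by linarith)
  have h2 : 2 * (n : ℝ) * (2 / δ / (n - 1)) ≤ 8 / δ := by
    rw [div_div, mul_div_assoc', div_le_div_iff₀ (by positivity) hδ]
    nlinarith
  have h3 : 2 / (δ / 2) * energy (fun _ : Fin n => t) (C.freeInd i₀) ≤ 8 / δ ^ 2 := by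
    refine (mul_le_mul_of_nonneg_left henergy (by positivity)).trans_eq ?_
    field_simp
    norm_num
  have h4 := mul_le_mul_of_nonneg_left h1 hlog
  linarith

/-- The mean dimension of doubly transitive codes at `1 - R` is sublinear in the length. -/
lemma eventually_meanDim_le {δ : ℝ} (hδ : 0 < δ) :
    ∀ᶠ n : ℕ in atTop, ∀ C : BinaryLinearCode n, C.IsDoublyTransitive →
      C.meanDim (1 - C.rate) ≤ δ * n := by
  have h1 : Tendsto (fun n : ℕ => Real.log (((n : ℝ) - 1) * δ / 2)) atTop atTop := by
    refine Real.tendsto_log_atTop.comp ?_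
    simp only [mul_div_assoc]
    exact (tendsto_atTop_add_const_right _ _ tendsto_natCast_atTop_atTop).atTop_mul_const
      (by positivity)
  filter_upwards [h1.eventually_gt_atTop ((8 / δ ^ 2 + 8 / δ) / (δ / 2 * δ)),
    h1.eventually_ge_atTop 0, eventually_ge_atTop 2] with n h2 h3 h4 C hC
  by_contra! h
  have := hC.log_le_of_lt_meanDim h4 hδ h h3
  rw [div_lt_iff₀ (by positivity)] at h2
  linarith

end BinaryLinearCode

/-! ### Weight enumerators and duality. -/

namespace BiasedCube

variable {ι : Type*} [Fintype ι] [DecidableEq ι]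

lemma ex_not (w : ι → ℝ) (f : (ι → Bool) → ℝ) :
    ex w f = ex (fun i => 1 - w i) (fun x => f (fun i => !x i)) := by
  unfold ex
  refine (Fintype.sum_bijective (fun (x : ι → Bool) i => !x i) ?_ _ _ fun x => ?_).symm
  · exact Function.Involutive.bijective fun x => by funext i; simp
  · rw [wt_not]

lemma ex_coord (w : ι → ℝ) (i : ι) : ex w (fun x => if x i then 1 else 0) = w i := by
  have h : avg w i (fun x => if x i then (1 : ℝ) else 0) = fun _ => w i := by
    funext x
    simp [avg]
  rw [← ex_avg w i, h, ex_const]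

end BiasedCube

namespace BinaryLinearCode

open BiasedCube

variable {n : ℕ}

lemma natCard_eq_two_rpow (C : BinaryLinearCode n) :
    (Nat.card C : ℝ) = 2 ^ (Module.finrank (ZMod 2) C : ℝ) := by
  rw [Module.natCard_eq_pow_finrank (K := ZMod 2), Nat.card_zmod, Real.rpow_natCast]
  norm_num

lemma pow_hammingNorm_eq_ex (z : Fin n → ZMod 2) (α : ℝ) :
    α ^ hammingNorm z =
      ex (fun _ => α) (fun x => if ∀ i, x i = false → z i = 0 then 1 else 0) := by
  have h := ex_prod (fun _ : Fin n => α) (fun i b => if b = false → z i = 0 then 1 else 0)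
  have e : ∀ x : Fin n → Bool, (∏ i, if x i = false → z i = 0 then (1 : ℝ) else 0) =
      if ∀ i, x i = false → z i = 0 then 1 else 0 := by
    intro x
    rw [Finset.prod_ite_zero]
    simp
  simp only [e] at h
  rw [h, hammingNorm, ← Finset.prod_const, Finset.prod_filter]
  refine Finset.prod_congr rfl fun i _ => ?_
  by_cases hz : z i = 0 <;> simp [hz]

open Classical in
/-- The weight enumerator of a coset at `α` is at most the mean size of the subcode supported
in a random set of coordinates. -/
lemma sum_pow_hammingNorm_le (C : BinaryLinearCode n) (v : Fin n → ZMod 2) {α : ℝ}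
    (h0 : 0 ≤ α) (h1 : α ≤ 1) :
    ∑ y with y ∈ C, α ^ hammingNorm (v + y) ≤
      ex (fun _ => α) (fun x => (2 : ℝ) ^ C.suppDim x) := by
  simp only [pow_hammingNorm_eq_ex]
  rw [← ex_sum]
  refine ex_mono (fun _ => h0) (fun _ => h1) fun x => ?_
  rw [Finset.sum_boole, suppDim, ← natCard_eq_two_rpow, Nat.cast_le, Finset.filter_filter]
  -- For fixed `x` this set is empty or a coset of `C.supportedIn x`; subtracting one element embeds
  -- it there.
  set S := Finset.univ.filter fun y => y ∈ C ∧ ∀ i, x i = false → (v + y) i = 0 with hS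
  rcases S.eq_empty_or_nonempty with h | ⟨y₀, hy₀⟩
  · simp [h]
  · simp only [hS, Finset.mem_filter, Finset.mem_univ, true_and] at hy₀
    change S.card ≤ (C.supportedIn x : Set (Fin n → ZMod 2)).ncard
    rw [← Set.ncard_coe_finset]
    refine Set.ncard_le_ncard_of_injOn (fun y => y - y₀) (fun y hy => ?_)
      (sub_left_injective.injOn) (Set.toFinite _)
    simp only [hS, Finset.coe_filter, Finset.mem_univ, true_and, Set.mem_ofPred_eq] at hy
    refine ⟨C.sub_mem hy.1 hy₀.1, fun i hi => ?_⟩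
    have a := hy.2 i hi
    have b := hy₀.2 i hi
    rw [Pi.add_apply] at a b
    rw [Pi.sub_apply, sub_eq_zero]
    exact add_left_cancel (a.trans b.symm)

lemma hammingNorm_one_add (y : Fin n → ZMod 2) :
    hammingNorm (1 + y) = n - hammingNorm y := by
  have h : ∀ a : ZMod 2, 1 + a ≠ 0 ↔ ¬ a ≠ 0 := by decide
  have := Finset.card_filter_add_card_filter_not (s := (Finset.univ : Finset (Fin n)))
    (fun i => y i ≠ 0)
  simp only [Finset.card_univ, Fintype.card_fin] at this
  simp only [hammingNorm, Pi.add_apply, Pi.one_apply, h]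
  omega

lemma weightDistribution_mul_pow_le (C : BinaryLinearCode n) (i : ℕ) {α : ℝ}
    (h0 : 0 ≤ α) (h1 : α ≤ 1) :
    (C.weightDistribution i : ℝ) * α ^ (min i (n - i)) ≤
      ex (fun _ => α) (fun x => (2 : ℝ) ^ C.suppDim x) := by
  classical
  -- Translation by the all-ones vector, which need not lie in `C`, turns weight i into n - i.
  obtain ⟨v, hv⟩ : ∃ v : Fin n → ZMod 2, ∀ y, hammingNorm y = i →
      hammingNorm (v + y) = min i (n - i) := by
    rcases le_total i (n - i) with h | h
    · exact ⟨0, fun y hy => by simp [hy, h]⟩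
    · exact ⟨1, fun y hy => by rw [hammingNorm_one_add, hy, min_eq_right h]⟩
  refine le_trans ?_ (C.sum_pow_hammingNorm_le v h0 h1)
  have e : C.weightDistribution i =
      (Finset.univ.filter fun y : Fin n → ZMod 2 => y ∈ C ∧ hammingNorm y = i).card := by
    rw [weightDistribution, ← Set.ncard_coe_finset]
    simp
  rw [e, ← nsmul_eq_mul, ← Finset.sum_const, ← Finset.filter_filter]
  rw [Finset.sum_congr rfl fun y hy => by rw [← hv y (Finset.mem_filter.1 hy).2]]
  exact Finset.sum_le_sum_of_subset_of_nonneg (Finset.filter_subset _ _)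
    fun y _ _ => pow_nonneg h0 _

lemma rate_mem_Icc (C : BinaryLinearCode n) : C.rate ∈ Set.Icc (0 : ℝ) 1 :=
  ⟨by unfold rate; positivity,
    div_le_one_of_le₀ (Nat.cast_le.2 C.finrank_le_length) (Nat.cast_nonneg _)⟩

lemma ex_two_rpow_suppDim_le (C : BinaryLinearCode n) {s : ℝ} (h0 : 0 ≤ s) (h1 : s ≤ 1) :
    ex (fun _ => (2 : ℝ) ^ s - 1) (fun x => (2 : ℝ) ^ C.suppDim x) ≤ 2 ^ C.meanDim s := by
  have a1 : (1 : ℝ) ≤ 2 ^ s := Real.one_le_rpow (by norm_num) h0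
  have a2 : (2 : ℝ) ^ s ≤ 2 := by
    simpa using Real.rpow_le_rpow_of_exponent_le (x := 2) (by norm_num) h1
  have hpos : ∀ x, 0 < (2 : ℝ) ^ C.suppDim x := fun x => by positivity
  have h := logb_ex_le (F := fun x => (2 : ℝ) ^ C.suppDim x) hpos
    (fun x i => Real.rpow_le_rpow_of_exponent_le (by norm_num) (C.suppDim_update_mono x i))
    (fun x i => by
      rw [suppDim_update_true, add_comm, Real.rpow_add (by norm_num)]
      refine mul_le_mul_of_nonneg_right ?_ (by positivity)
      simpa using Real.rpow_le_rpow_of_exponent_le (x := 2) (by norm_num)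
        (C.freeInd_mem_Icc i x).2)
    (θ := fun _ => (2 : ℝ) ^ s - 1) (fun _ => by linarith) (fun _ => by linarith)
  simp only [add_sub_cancel, Real.logb_rpow (by norm_num : (0 : ℝ) < 2) (by norm_num)] at h
  rwa [Real.logb_le_iff_le_rpow (by norm_num)
    (ex_pos (fun _ => by linarith) (fun _ => by linarith) hpos)] at h

/-- The size of the subcode of the dual code supported in `{i | x i = true}`. -/
noncomputable def dualSupp (C : BinaryLinearCode n) (x : Fin n → Bool) : ℝ :=
  2 ^ (C.suppDim (fun i => !x i) + ∑ i, (if x i then 1 else 0) - Module.finrank (ZMod 2) C)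

lemma dualSupp_pos (C : BinaryLinearCode n) (x : Fin n → Bool) : 0 < C.dualSupp x := by
  unfold dualSupp; positivity

/-- The factor lies between 1 and 2, so `logb_ex_le` applies to `dualSupp` as well. -/
lemma dualSupp_update_true (C : BinaryLinearCode n) (x : Fin n → Bool) (i : Fin n) :
    C.dualSupp (Function.update x i true) =
      2 ^ (1 - C.freeInd i fun j => !x j) * C.dualSupp (Function.update x i false) := by
  have e : ∀ b, (fun j => !Function.update x i b j) =
      Function.update (fun j => !x j) i (!b) := by
    intro b
    funext j
    by_cases h : j = i
    · subst h; simp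
    · simp [h]
  have e2 : ∀ b : Bool, (∑ j, if Function.update x i b j then (1 : ℝ) else 0) =
      (if b then 1 else 0) + ∑ j ∈ Finset.univ.erase i, if x j then (1 : ℝ) else 0 := by
    intro b
    rw [← Finset.add_sum_erase _ _ (Finset.mem_univ i)]
    congr 1
    · simp
    · refine Finset.sum_congr rfl fun j hj => ?_
      rw [Function.update_of_ne (Finset.ne_of_mem_erase hj)]
  unfold dualSupp
  rw [← Real.rpow_add (by norm_num), e, e, e2, e2]
  simp only [Bool.not_true, Bool.not_false, suppDim_update_true]
  congr 1
  simp
  ring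

/-- At bias R the mean exponent is D(1 - R) + Rn - k = D(1 - R). Smaller β only lower the bias
log₂(1 + β), and the exponent is monotone. -/
lemma ex_dualSupp_le (C : BinaryLinearCode n) (hn : 0 < n) {β : ℝ} (h0 : 0 ≤ β)
    (h1 : β ≤ 2 ^ C.rate - 1) :
    ex (fun _ => β) C.dualSupp ≤ 2 ^ C.meanDim (1 - C.rate) := by
  obtain ⟨hR0, hR1⟩ := C.rate_mem_Icc
  have a2 : (2 : ℝ) ^ C.rate ≤ 2 := by
    simpa using Real.rpow_le_rpow_of_exponent_le (x := 2) (by norm_num) hR1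
  have hmono : ∀ x i, C.dualSupp (Function.update x i false) ≤
      C.dualSupp (Function.update x i true) := by
    intro x i
    rw [dualSupp_update_true]
    refine le_mul_of_one_le_left (C.dualSupp_pos _).le (Real.one_le_rpow (by norm_num) ?_)
    linarith [(C.freeInd_mem_Icc i fun j => !x j).2]
  have h := logb_ex_le C.dualSupp_pos hmono
    (fun x i => by
      rw [dualSupp_update_true]
      refine mul_le_mul_of_nonneg_right ?_ (C.dualSupp_pos _).le
      have : 1 - C.freeInd i (fun j => !x j) ≤ 1 := by
        linarith [(C.freeInd_mem_Icc i fun j => !x j).1]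
      simpa using Real.rpow_le_rpow_of_exponent_le (x := 2) (by norm_num) this)
    (θ := fun _ => β) (fun _ => h0) (fun _ => by linarith)
  rw [← Real.logb_le_iff_le_rpow (by norm_num)
    (ex_pos (fun _ => h0) (fun _ => by linarith) C.dualSupp_pos)]
  refine h.trans ?_
  have b0 : 0 ≤ Real.logb 2 (1 + β) := Real.logb_nonneg (by norm_num) (by linarith)
  have b1 : Real.logb 2 (1 + β) ≤ C.rate := by
    rw [Real.logb_le_iff_le_rpow (by norm_num) (by linarith)]; linarith
  refine (ex_diag_monotoneOn (f := fun x => Real.logb 2 (C.dualSupp x))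
    (fun x i => Real.logb_le_logb_of_le (by norm_num) (C.dualSupp_pos _) (hmono x i))
    ⟨b0, b1.trans hR1⟩ ⟨hR0, hR1⟩ b1).trans_eq ?_
  simp only [dualSupp, Real.logb_rpow (by norm_num : (0 : ℝ) < 2) (by norm_num)]
  rw [ex_sub, ex_add, ex_const, ex_sum, ex_not]
  simp only [ex_coord, Bool.not_not]
  have : (n : ℝ) ≠ 0 := by positivity
  simp [meanDim, rate]
  field_simp
  ring

/-- A form of the MacWilliams identity. It holds term by term after complementing `x`: with β = (1 -
α)/(1 + α), the weights 1 - β and 2β on one coordinate are 2/(1 + α) times α and 1 - α. -/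
lemma ex_suppDim_eq_ex_dualSupp (C : BinaryLinearCode n) {α : ℝ} (h0 : 0 ≤ α) :
    ex (fun _ => α) (fun x => (2 : ℝ) ^ C.suppDim x) =
      Nat.card C / 2 ^ n * (1 + α) ^ n * ex (fun _ => (1 - α) / (1 + α)) C.dualSupp := by
  rw [ex_not (fun _ => (1 - α) / (1 + α)), ex, ex, Finset.mul_sum]
  refine Finset.sum_congr rfl fun x _ => ?_
  have e1 : (2 : ℝ) ^ (∑ i, if (!x i) = true then (1 : ℝ) else 0) =
      ∏ i, if x i then 1 else 2 := by
    rw [Real.rpow_sum_of_pos (by norm_num)]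
    refine Finset.prod_congr rfl fun i _ => ?_
    cases x i <;> simp
  have e2 : wt (fun _ => 1 - (1 - α) / (1 + α)) x * (∏ i, if x i then (1 : ℝ) else 2) =
      (2 / (1 + α)) ^ n * wt (fun _ => α) x := by
    have : (2 / (1 + α)) ^ n = ∏ _i : Fin n, 2 / (1 + α) := by
      rw [Finset.prod_const, Finset.card_univ, Fintype.card_fin]
    rw [this, wt, wt, ← Finset.prod_mul_distrib, ← Finset.prod_mul_distrib]
    refine Finset.prod_congr rfl fun i _ => ?_
    have : 1 + α ≠ 0 := by positivity
    cases x i <;> simp <;> field_simp <;> ring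
  have h2 : (0 : ℝ) < 2 := by norm_num
  simp only [dualSupp, Bool.not_not]
  rw [Real.rpow_sub h2, Real.rpow_add h2, e1, natCard_eq_two_rpow]
  have e3 : (2 : ℝ) ^ n * (1 + α) ^ n * (2 / (1 + α)) ^ n = 2 ^ n * 2 ^ n := by
    have : 1 + α ≠ 0 := by positivity
    rw [mul_assoc, ← mul_pow, mul_div_cancel₀ _ this]
  set K := (2 : ℝ) ^ (Module.finrank (ZMod 2) C : ℝ) with hK
  have hKpos : 0 < K := by positivity
  have e4 : (1 + α) ^ n * (2 / (1 + α)) ^ n = 2 ^ n := by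
    have : 1 + α ≠ 0 := by positivity
    rw [← mul_pow, mul_div_cancel₀ _ this]
  calc wt (fun _ => α) x * 2 ^ C.suppDim x
      = 1 / 2 ^ n * 2 ^ n * (wt (fun _ => α) x) * 2 ^ C.suppDim x := by field_simp
    _ = 1 / 2 ^ n * ((1 + α) ^ n * ((2 / (1 + α)) ^ n * wt (fun _ => α) x)) *
          2 ^ C.suppDim x := by rw [← e4]; ring
    _ = _ := by rw [← e2]; field_simp

lemma weightDistribution_mul_pow_le_dual (C : BinaryLinearCode n) (hn : 0 < n) (i : ℕ) {α : ℝ}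
    (h0 : 0 ≤ α) (h1 : α ≤ 1) (hα : (1 - α) / (1 + α) ≤ 2 ^ C.rate - 1) :
    (C.weightDistribution i : ℝ) * α ^ (min i (n - i)) ≤
      Nat.card C / 2 ^ n * (1 + α) ^ n * 2 ^ C.meanDim (1 - C.rate) := by
  refine (C.weightDistribution_mul_pow_le i h0 h1).trans ?_
  rw [C.ex_suppDim_eq_ex_dualSupp h0]
  exact mul_le_mul_of_nonneg_left
    (C.ex_dualSupp_le hn (div_nonneg (by linarith) (by linarith)) hα) (by positivity)

end BinaryLinearCode

/-! ### A lower bound for binomial coefficients. -/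

/-- The largest term in the binomial expansion of `(j + (n - j)) ^ n` is the `j`-th one. -/
lemma choose_mul_pow_mul_pow_le {n j m : ℕ} (hj : j ≤ n) (hm : m ≤ n) :
    n.choose m * j ^ m * (n - j) ^ (n - m) ≤ n.choose j * j ^ j * (n - j) ^ (n - j) := by
  obtain ⟨b, rfl⟩ := Nat.exists_eq_add_of_le hj
  simp only [Nat.add_sub_cancel_left]
  set T : ℕ → ℕ := fun m => (j + b).choose m * j ^ m * b ^ (j + b - m) with hT
  -- Consecutive terms are in the ratio j(n - m) : b(m + 1); the common factor `q` avoids division.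
  have h1 : ∀ m, m < j + b → ∃ q, T (m + 1) * (m + 1) = q * (j * (j + b - m)) ∧
      T m * (m + 1) = q * (b * (m + 1)) := by
    intro m hm
    refine ⟨(j + b).choose m * j ^ m * b ^ (j + b - (m + 1)), ?_, ?_⟩
    · have := Nat.choose_succ_right_eq (j + b) m
      simp only [hT]
      calc (j + b).choose (m + 1) * j ^ (m + 1) * b ^ (j + b - (m + 1)) * (m + 1)
          = ((j + b).choose (m + 1) * (m + 1)) * j ^ (m + 1) * b ^ (j + b - (m + 1)) := by ring
        _ = _ := by rw [this]; ring
    · have : j + b - m = j + b - (m + 1) + 1 := by omega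
      simp only [hT]
      rw [this]; ring
  have up : ∀ m, m < j → T m ≤ T (m + 1) := by
    intro m hm
    obtain ⟨q, e1, e2⟩ := h1 m (by omega)
    refine Nat.le_of_mul_le_mul_right ?_ m.succ_pos
    rw [Nat.succ_eq_add_one, e1, e2]
    refine Nat.mul_le_mul_left q ?_
    obtain ⟨c, rfl⟩ := Nat.exists_eq_add_of_lt hm
    have : m + c + 1 + b - m = c + 1 + b := by omega
    rw [this]; nlinarith
  have down : ∀ m, j ≤ m → m < j + b → T (m + 1) ≤ T m := by
    intro m hm hm'
    obtain ⟨q, e1, e2⟩ := h1 m hm'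
    refine Nat.le_of_mul_le_mul_right ?_ m.succ_pos
    rw [Nat.succ_eq_add_one, e1, e2]
    refine Nat.mul_le_mul_left q ?_
    obtain ⟨c, rfl⟩ := Nat.exists_eq_add_of_le hm
    obtain ⟨d, rfl⟩ : ∃ d, b = c + d := ⟨b - c, by omega⟩
    have : j + (c + d) - (j + c) = d := by omega
    rw [this]; nlinarith
  suffices H : T m ≤ T j by simpa only [hT, Nat.add_sub_cancel_left] using H
  rcases le_total m j with h | h
  · obtain ⟨c, hc⟩ := Nat.exists_eq_add_of_le h
    clear hm
    induction c generalizing m with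
    | zero => simp [hc]
    | succ c ih => exact (up m (by omega)).trans (ih (m := m + 1) (by omega) (by omega))
  · induction m, h using Nat.le_induction with
    | base => rfl
    | succ m hjm ih => exact (down m hjm (by omega)).trans (ih (by omega))

lemma pow_self_le_succ_mul_choose {n j : ℕ} (hj : j ≤ n) :
    n ^ n ≤ (n + 1) * (n.choose j * j ^ j * (n - j) ^ (n - j)) := by
  have h := add_pow j (n - j) n
  rw [Nat.add_sub_cancel' hj] at h
  calc n ^ n = _ := h
    _ ≤ ∑ _m ∈ Finset.range (n + 1), n.choose j * j ^ j * (n - j) ^ (n - j) :=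
        Finset.sum_le_sum fun m hm => by
          refine le_trans (le_of_eq ?_)
            (choose_mul_pow_mul_pow_le hj (Nat.lt_succ_iff.1 (Finset.mem_range.1 hm)))
          simp only [Nat.cast_id]
          ring
    _ = _ := by simp

/-! ### The bounds for a single code, and the uniform error term. -/

namespace BinaryLinearCode

variable {n : ℕ}

lemma weightDistribution_le_of_rate_lt_one (C : BinaryLinearCode n) (hR : C.rate < 1) (i : ℕ) :
    (C.weightDistribution i : ℝ) ≤ 2 ^ C.meanDim (1 - C.rate) *
      (1 / ((2 : ℝ) ^ (1 - C.rate) - 1)) ^ (min i (n - i)) := by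
  obtain ⟨hR0, -⟩ := C.rate_mem_Icc
  have a1 : (1 : ℝ) < 2 ^ (1 - C.rate) := Real.one_lt_rpow (by norm_num) (by linarith)
  have a2 : (2 : ℝ) ^ (1 - C.rate) ≤ 2 := by
    simpa using Real.rpow_le_rpow_of_exponent_le (x := 2) (y := 1 - C.rate) (z := 1)
      (by norm_num) (by linarith)
  have h := (C.weightDistribution_mul_pow_le i (α := 2 ^ (1 - C.rate) - 1) (by linarith)
    (by linarith)).trans (C.ex_two_rpow_suppDim_le (by linarith) (by linarith))
  rw [one_div, inv_pow, ← div_eq_mul_inv, le_div_iff₀ (pow_pos (by linarith) _)]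
  exact h

/-- With r = 2^R, the dual bound admits exactly the α in [(2 - r)/r, 1]; here the left endpoint is
used. -/
lemma weightDistribution_le_of_le (C : BinaryLinearCode n) (hn : 0 < n) {i : ℕ} (hi : i ≤ n)
    (h : ((min i (n - i) : ℕ) : ℝ) ≤ (1 - (2 : ℝ) ^ (C.rate - 1)) * n) :
    (C.weightDistribution i : ℝ) ≤ 2 ^ C.meanDim (1 - C.rate) *
      ((Nat.card C : ℝ) / ((2 - (2 : ℝ) ^ C.rate) ^ (min i (n - i)) *
        ((2 : ℝ) ^ C.rate) ^ (n - min i (n - i)))) := by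
  obtain ⟨hR0, hR1⟩ := C.rate_mem_Icc
  have e : (2 : ℝ) ^ (C.rate - 1) = 2 ^ C.rate / 2 := by
    rw [Real.rpow_sub (by norm_num), Real.rpow_one]
  have a1 : (1 : ℝ) ≤ 2 ^ C.rate := Real.one_le_rpow (by norm_num) hR0
  have a2 : (2 : ℝ) ^ C.rate ≤ 2 := by
    simpa using Real.rpow_le_rpow_of_exponent_le (x := 2) (by norm_num) hR1
  rw [e] at h
  set r := (2 : ℝ) ^ C.rate with hr
  have hr0 : 0 < r := by linarith
  have key := C.weightDistribution_mul_pow_le_dual hn i (α := (2 - r) / r)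
    (div_nonneg (by linarith) hr0.le) (by rw [div_le_one hr0]; linarith)
    (le_of_eq (by rw [← hr]; field_simp; ring))
  have e2 : 1 + (2 - r) / r = 2 / r := by field_simp; ring
  have hjn : min i (n - i) ≤ n := (min_le_left _ _).trans hi
  set j := min i (n - i) with hj
  -- For R = 1 the base vanishes, but then `h` forces j = 0 and the power is 0^0 = 1.
  have hpos : 0 < (2 - r) ^ j := by
    rcases a2.eq_or_lt with h2 | h2
    · have : j = 0 := by
        have : (j : ℝ) ≤ 0 := by rw [h2] at h; linarith
        exact_mod_cast this.antisymm (Nat.cast_nonneg _)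
      simp [this]
    · exact pow_pos (by linarith) _
  rw [mul_div_assoc', le_div_iff₀ (by positivity)]
  rw [e2, div_pow, div_pow, mul_div_assoc', div_le_iff₀ (by positivity)] at key
  have e3 : r ^ j * r ^ (n - j) = r ^ n := by rw [← pow_add, Nat.add_sub_cancel' hjn]
  calc (C.weightDistribution i : ℝ) * ((2 - r) ^ j * r ^ (n - j))
      = (C.weightDistribution i : ℝ) * (2 - r) ^ j * r ^ (n - j) := by ring
    _ ≤ (Nat.card C : ℝ) / 2 ^ n * (2 ^ n / r ^ n) * 2 ^ C.meanDim (1 - C.rate) * r ^ j *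
          r ^ (n - j) := mul_le_mul_of_nonneg_right key (by positivity)
    _ = (Nat.card C : ℝ) / 2 ^ n * (2 ^ n / r ^ n) * 2 ^ C.meanDim (1 - C.rate) *
          (r ^ j * r ^ (n - j)) := by ring
    _ = _ := by rw [e3]; field_simp

/-- Above the threshold the minimiser α = j/(n - j) of (1 + α)^n / α^j is admissible. The minimum
n^n / (j^j (n - j)^(n - j)) is at most n + 1 times the binomial coefficient. -/
lemma weightDistribution_le_of_lt (C : BinaryLinearCode n) (hn : 0 < n) {i : ℕ} (hi : i ≤ n)
    (h : (1 - (2 : ℝ) ^ (C.rate - 1)) * n < ((min i (n - i) : ℕ) : ℝ)) :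
    (C.weightDistribution i : ℝ) ≤ 2 ^ C.meanDim (1 - C.rate) * (n + 1) *
      ((n.choose (min i (n - i)) : ℝ) * (Nat.card C : ℝ) / 2 ^ n) := by
  obtain ⟨hR0, hR1⟩ := C.rate_mem_Icc
  have e : (2 : ℝ) ^ (C.rate - 1) = 2 ^ C.rate / 2 := by
    rw [Real.rpow_sub (by norm_num), Real.rpow_one]
  have a2 : (2 : ℝ) ^ C.rate ≤ 2 := by
    simpa using Real.rpow_le_rpow_of_exponent_le (x := 2) (by norm_num) hR1
  rw [e] at h
  set r := (2 : ℝ) ^ C.rate with hr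
  have hn0 : (0 : ℝ) < n := by positivity
  set j := min i (n - i) with hj
  have hjn : j ≤ n := (min_le_left _ _).trans hi
  have h2j : 2 * j ≤ n := by omega
  have hj0 : (0 : ℝ) < j := lt_of_le_of_lt (mul_nonneg (by linarith) hn0.le) h
  have h2j' : 2 * (j : ℝ) ≤ n := by exact_mod_cast h2j
  set b : ℝ := n - j with hb
  have hb0 : 0 < b := by linarith
  have key := C.weightDistribution_mul_pow_le_dual hn i (α := j / b) (by positivity)
    (by rw [div_le_one hb0]; linarith)
    (by
      have : (1 - j / b) / (1 + j / b) = (n - 2 * j) / n := by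
        have e1 : 1 - j / b = (n - 2 * j) / b := by field_simp; rw [hb]; ring
        have e2 : 1 + j / b = n / b := by field_simp; rw [hb]; ring
        rw [e1, e2]; field_simp
      rw [this, div_le_iff₀ hn0, ← hr]
      linarith)
  have e2 : 1 + j / b = n / b := by field_simp; rw [hb]; ring
  rw [← hj, e2, div_pow, div_pow, mul_div_assoc', div_le_iff₀ (by positivity)] at key
  have hbin : (n : ℝ) ^ n ≤ (n + 1) * (n.choose j * (j : ℝ) ^ j * b ^ (n - j)) := by
    have := pow_self_le_succ_mul_choose hjn
    rw [hb, ← Nat.cast_sub hjn]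
    exact_mod_cast this
  have e3 : b ^ j * b ^ (n - j) = b ^ n := by rw [← pow_add, Nat.add_sub_cancel' hjn]
  have hjb : 0 < (j : ℝ) ^ j * b ^ (n - j) := by positivity
  refine le_of_mul_le_mul_right ?_ hjb
  calc (C.weightDistribution i : ℝ) * ((j : ℝ) ^ j * b ^ (n - j))
      = (C.weightDistribution i : ℝ) * (j : ℝ) ^ j * b ^ (n - j) := by ring
    _ ≤ (Nat.card C : ℝ) / 2 ^ n * (n ^ n / b ^ n) * 2 ^ C.meanDim (1 - C.rate) * b ^ j *
          b ^ (n - j) := mul_le_mul_of_nonneg_right key (by positivity)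
    _ = (Nat.card C : ℝ) / 2 ^ n * 2 ^ C.meanDim (1 - C.rate) * n ^ n *
          (b ^ j * b ^ (n - j) / b ^ n) := by ring
    _ = (Nat.card C : ℝ) / 2 ^ n * 2 ^ C.meanDim (1 - C.rate) * n ^ n := by
          rw [e3, div_self (by positivity), mul_one]
    _ ≤ (Nat.card C : ℝ) / 2 ^ n * 2 ^ C.meanDim (1 - C.rate) *
          ((n + 1) * (n.choose j * (j : ℝ) ^ j * b ^ (n - j))) :=
        mul_le_mul_of_nonneg_left hbin (by positivity)
    _ = _ := by ring

lemma meanDim_nonneg (C : BinaryLinearCode n) : 0 ≤ C.meanDim (1 - C.rate) := by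
  obtain ⟨hR0, hR1⟩ := C.rate_mem_Icc
  exact BiasedCube.ex_nonneg (fun _ => by linarith) (fun _ => by linarith) C.suppDim_nonneg

/-- The largest mean dimension of a doubly transitive code of length `n` at `1 - R`. -/
noncomputable def maxMeanDim (n : ℕ) : ℝ :=
  ⨆ C : {C : BinaryLinearCode n // C.IsDoublyTransitive}, C.1.meanDim (1 - C.1.rate)

/-- There are finitely many codes of length n, so the supremum is over a bounded set and is not the
default value 0. -/
lemma IsDoublyTransitive.meanDim_le {C : BinaryLinearCode n} (hC : C.IsDoublyTransitive) :
    C.meanDim (1 - C.rate) ≤ maxMeanDim n :=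
  haveI : Finite (BinaryLinearCode n) :=
    Finite.of_injective (fun C : BinaryLinearCode n => (C : Set (Fin n → ZMod 2)))
      SetLike.coe_injective
  le_ciSup (f := fun C : {C : BinaryLinearCode n // C.IsDoublyTransitive} =>
    C.1.meanDim (1 - C.1.rate)) (Set.finite_range _).bddAbove ⟨C, hC⟩

lemma maxMeanDim_nonneg (n : ℕ) : 0 ≤ maxMeanDim n :=
  Real.iSup_nonneg fun C => C.1.meanDim_nonneg

lemma maxMeanDim_isLittleO : maxMeanDim =o[atTop] (fun n : ℕ => (n : ℝ)) := by
  rw [isLittleO_iff]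
  intro δ hδ
  filter_upwards [eventually_meanDim_le hδ] with n hn
  rw [Real.norm_of_nonneg (maxMeanDim_nonneg n), Real.norm_of_nonneg (Nat.cast_nonneg n)]
  exact Real.iSup_le (fun C => hn C.1 C.2) (by positivity)

end BinaryLinearCode

lemma logb_natCast_add_one_isLittleO :
    (fun n : ℕ => Real.logb 2 ((n : ℝ) + 1)) =o[atTop] (fun n : ℕ => (n : ℝ)) := by
  have h1 : (fun n : ℕ => Real.log ((n : ℝ) + 1)) =o[atTop] (fun n : ℕ => (n : ℝ) + 1) :=
    Real.isLittleO_log_id_atTop.comp_tendsto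
      (tendsto_atTop_add_const_right _ _ tendsto_natCast_atTop_atTop)
  have h2 : (fun n : ℕ => (n : ℝ) + 1) =O[atTop] (fun n : ℕ => (n : ℝ)) := by
    refine IsBigO.of_bound 2 ?_
    filter_upwards [eventually_ge_atTop 1] with n hn
    have : (1 : ℝ) ≤ n := by exact_mod_cast hn
    rw [Real.norm_of_nonneg (by positivity), Real.norm_of_nonneg (by positivity)]
    linarith
  have h3 := (h1.trans_isBigO h2).const_mul_left (Real.log 2)⁻¹
  refine h3.congr_left fun n => ?_
  rw [Real.logb, div_eq_inv_mul]

theorem proposition1p3 :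
    ∃ ε : ℕ → ℝ, ε =o[atTop] (fun n : ℕ => (n : ℝ)) ∧
      ∀ n : ℕ, 0 < n → ∀ C : BinaryLinearCode n, C.IsDoublyTransitive → ∀ i : ℕ, i ≤ n →
        (C.rate < 1 →
          (C.weightDistribution i : ℝ) ≤
            (2 : ℝ) ^ ε n * (1 / ((2 : ℝ) ^ (1 - C.rate) - 1)) ^ (min i (n - i))) ∧
        (C.weightDistribution i : ℝ) ≤
          (2 : ℝ) ^ ε n *
            (if ((min i (n - i) : ℕ) : ℝ) ≤ (1 - (2 : ℝ) ^ (C.rate - 1)) * n then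
              (Nat.card C : ℝ) /
                ((2 - (2 : ℝ) ^ C.rate) ^ (min i (n - i)) *
                  ((2 : ℝ) ^ C.rate) ^ (n - min i (n - i)))
            else
              (n.choose (min i (n - i)) : ℝ) * (Nat.card C : ℝ) / 2 ^ n) := by
  -- The logarithm absorbs the factor n + 1 lost in the binomial case.
  refine ⟨fun n => BinaryLinearCode.maxMeanDim n + Real.logb 2 ((n : ℝ) + 1),
    BinaryLinearCode.maxMeanDim_isLittleO.add logb_natCast_add_one_isLittleO,
    fun n hn C hC i hi => ?_⟩
  obtain ⟨hR0, hR1⟩ := C.rate_mem_Icc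
  have hpow : (2 : ℝ) ^ C.meanDim (1 - C.rate) * (n + 1) ≤
      2 ^ (BinaryLinearCode.maxMeanDim n + Real.logb 2 ((n : ℝ) + 1)) := by
    rw [Real.rpow_add (by norm_num), Real.rpow_logb (by norm_num) (by norm_num) (by positivity)]
    exact mul_le_mul_of_nonneg_right
      (Real.rpow_le_rpow_of_exponent_le (by norm_num) hC.meanDim_le) (by positivity)
  have hpow' : (2 : ℝ) ^ C.meanDim (1 - C.rate) ≤
      2 ^ (BinaryLinearCode.maxMeanDim n + Real.logb 2 ((n : ℝ) + 1)) :=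
    (le_mul_of_one_le_right (by positivity) (by linarith [Nat.cast_nonneg (α := ℝ) n])).trans
      hpow
  have a2 : (2 : ℝ) ^ C.rate ≤ 2 := by
    simpa using Real.rpow_le_rpow_of_exponent_le (x := 2) (by norm_num) hR1
  refine ⟨fun hR => (C.weightDistribution_le_of_rate_lt_one hR i).trans
    (mul_le_mul_of_nonneg_right hpow' (pow_nonneg (one_div_nonneg.2 ?_) _)), ?_⟩
  · exact sub_nonneg.2 (Real.one_le_rpow (by norm_num) (by linarith))
  · split_ifs with h
    · refine (C.weightDistribution_le_of_le hn hi h).trans (mul_le_mul_of_nonneg_right hpow' ?_)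
      have : 0 ≤ 2 - (2 : ℝ) ^ C.rate := by linarith
      positivity
    · exact (C.weightDistribution_le_of_lt hn hi (not_le.1 h)).trans
        (mul_le_mul_of_nonneg_right hpow (by positivity))
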